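/- For $x\in\mathbb{R}$ let $\|x\|=\min\{\{x\},1-\{x\}\}$ be the distance from $x$ to the nearest integer. For irrational $\alpha$ and real $t\ge 1$ let $\psi_\alpha(t)=\min_{1\le q\le t}\|q\alpha\|$, where $q$ runs over the integers, and let $d(\alpha)=\limsup_{t\to\infty} t\,\psi_\alpha(t)$. Let $\mathbb{D}=\{d(\alpha):\alpha\in\mathbb{R}\setminus\mathbb{Q}\}$ be the Dirichlet spectrum, and let $$\delta=\inf\{d\in\mathbb{R}:(d,1]\subset\mathbb{D}\}.$$ Then this infimum is a finite real number, and $$\delta\le\frac{111\,(397+\sqrt{26565})}{65522},$$ where the right-hand side is $\approx 0.94866$ (with error less than $10^{-5}$). -/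

import Mathlib

noncomputable section

/-- The distance `‖x‖ = min {{x}, 1 - {x}}` from a real number to the nearest integer. -/
def distNearestInt (x : ℝ) : ℝ := min (Int.fract x) (1 - Int.fract x)

/-- The irrationality measure function `ψ_α(t) = min_{1 ≤ q ≤ t} ‖q α‖`, with `q` an integer.
For `t ≥ 1` the infimum is over a finite nonempty set, hence a minimum. -/
def irrationalityMeasureFun (α t : ℝ) : ℝ :=
  sInf ((fun q : ℕ => distNearestInt (q * α)) '' {q : ℕ | 1 ≤ q ∧ (q : ℝ) ≤ t})

/-- The Dirichlet constant `d(α) = limsup_{t → ∞} t ψ_α(t)`, with `t` a real variable. The function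
`t ψ_α(t)` takes values in `[0, 1]` for `t ≥ 1`, so this is the usual upper limit. -/
def dirichletConstant (α : ℝ) : ℝ :=
  Filter.limsup (fun t : ℝ => t * irrationalityMeasureFun α t) Filter.atTop

/-- The Dirichlet spectrum: all values of `d(α)` at irrational `α`. -/
def dirichletSpectrum : Set ℝ := {d : ℝ | ∃ α : ℝ, Irrational α ∧ d = dirichletConstant α}

/-- The real numbers `d` with `(d, 1] ⊆ 𝔻`. -/
def dirichletRayPoints : Set ℝ := {d : ℝ | Set.Ioc d 1 ⊆ dirichletSpectrum}

/-- The ray-origin constant `δ = inf {d ∈ ℝ : (d, 1] ⊆ 𝔻}`. -/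
def rayOriginConstant : ℝ := sInf dirichletRayPoints

end

/-! Write α = [0; a_0, a_1, …]. Between consecutive convergent denominators ψ_α is constant, so d(α)
is the limsup of the products of a denominator with the preceding error. Each of these is X/(X+1),
where X is the product of [a_n; a_{n-1}, …, a_0] and [a_{n+1}; a_{n+2}, …] (`cfDen_mul_cfError_eq`).
For bounded terms, d(α) = M/(M+1) with M the limsup of X. So it suffices to realize every T ≥ T₀ =
(3 + `extremalTail`) * `extremalValue` ≈ 18.48 as such an M. The endpoint d = 1 comes from unbounded
terms.

To realize T, find integers p ≥ 4 and q ∈ {p, p + 1} and tails u, v with (p + [0; u])(q + [0; v]) =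
T (`CylNode.exists_tails`). Then concatenate blocks in which p, q stands between ever longer pieces
of u (reversed) and v, with a 2 as separator. The central products tend to T, and all others must
stay at most T. For p = q = 4 this dictates the class of tails: terms at most 4, without 44 and
without 41414, also after a preceding 4. The two central 4s then form the only pair 44, and every
other product is at most T₀ (`cutProduct_le_extremal`). For the other pairs p, q cruder estimates
suffice (`mem_dirichletSpectrum_of_large`).

Existence of u, v says that the sum of two Cantor sets, the logarithms of p + [0; u] and of q + [0;
v], contains log T. Both sets are given by binary trees of intervals whose gaps are no longer than
the adjacent pieces and do not grow along branches. For such trees, a pair of linked intervals can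
be refined forever (`GapTree.Linked.exists_desc`), and the limit is a pair of points with the
required sum. The gap inequalities on the logarithmic scale are integrals, over a parameter t, of
inequalities between lengths under z ↦ z/(1 + t z). These need checking only for the five automaton
states and an explicit range of t, uniformly in p. -/

/-! ### Values of infinite continued fractions -/

/-- The sequence with its first `n` terms dropped. -/
def dropTerms (n : ℕ) (a : ℕ → ℕ) : ℕ → ℕ := fun i => a (n + i)

/-- `[0; a 0, …, a (n - 1) + z]`, with `z` itself for `n = 0`. -/
noncomputable def cfPrefix : ℕ → (ℕ → ℕ) → ℝ → ℝ
  | 0, _, z => z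
  | n + 1, a, z => 1 / (a 0 + cfPrefix n (dropTerms 1 a) z)

/-- The value of the infinite continued fraction `[0; a 0, a 1, …]`. -/
noncomputable def cfValue (a : ℕ → ℕ) : ℝ :=
  Filter.atTop.limUnder fun n => cfPrefix n a 0

lemma dropTerms_dropTerms (m n : ℕ) (a : ℕ → ℕ) :
    dropTerms m (dropTerms n a) = dropTerms (n + m) a := by
  funext i; simp [dropTerms, add_assoc]

lemma dropTerms_pos {a : ℕ → ℕ} (ha : ∀ i, 1 ≤ a i) (n : ℕ) : ∀ i, 1 ≤ dropTerms n a i :=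
  fun _ => ha _

lemma one_div_natCast_add_mem {d : ℕ} (hd : 1 ≤ d) {z : ℝ} (hz : z ∈ Set.Icc (0 : ℝ) 1) :
    1 / (d + z) ∈ Set.Icc (0 : ℝ) 1 := by
  have h1 : (1 : ℝ) ≤ d := by exact_mod_cast hd
  have h0 := hz.1
  constructor
  · positivity
  · rw [div_le_one (by linarith)]; linarith

lemma cfPrefix_mem {a : ℕ → ℕ} (ha : ∀ i, 1 ≤ a i) (n : ℕ) {z : ℝ} (hz : z ∈ Set.Icc (0 : ℝ) 1) :
    cfPrefix n a z ∈ Set.Icc (0 : ℝ) 1 := by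
  induction n generalizing a with
  | zero => exact hz
  | succ n ih => exact one_div_natCast_add_mem (ha 0) (ih (dropTerms_pos ha 1))

lemma cfPrefix_add (m n : ℕ) (a : ℕ → ℕ) (z : ℝ) :
    cfPrefix (n + m) a z = cfPrefix n a (cfPrefix m (dropTerms n a) z) := by
  induction n generalizing a with
  | zero =>
    have : dropTerms 0 a = a := by funext i; simp [dropTerms]
    simp [cfPrefix, this]
  | succ n ih =>
    rw [add_right_comm]
    simp only [cfPrefix]
    rw [ih, dropTerms_dropTerms, add_comm 1 n]

/-- One step z ↦ 1/(d + z) does not contract uniformly: for d = 1 its derivative at 0 is -1. In two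
steps both factors of the denominator are at least 2, which gives 1/4. -/
lemma abs_one_div_add_sub_le {d e : ℕ} (hd : 1 ≤ d) (he : 1 ≤ e) {y z : ℝ}
    (hy : y ∈ Set.Icc (0 : ℝ) 1) (hz : z ∈ Set.Icc (0 : ℝ) 1) :
    |1 / (d + 1 / (e + y)) - 1 / (d + 1 / (e + z))| ≤ 1 / 4 * |y - z| := by
  have h1 : (1 : ℝ) ≤ d := by exact_mod_cast hd
  have h2 : (1 : ℝ) ≤ e := by exact_mod_cast he
  obtain ⟨hy0, -⟩ := hy
  obtain ⟨hz0, -⟩ := hz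
  have key : 1 / ((d : ℝ) + 1 / (e + y)) - 1 / (d + 1 / (e + z)) =
      (y - z) / ((d * (e + y) + 1) * (d * (e + z) + 1)) := by
    field_simp; ring
  have a1 : (1 : ℝ) ≤ d * (e + y) := by nlinarith
  have a2 : (1 : ℝ) ≤ d * (e + z) := by nlinarith
  rw [key, abs_div, div_le_iff₀ (by positivity), abs_of_pos (a := (_ * _ : ℝ)) (by positivity)]
  have : (4 : ℝ) ≤ (d * (e + y) + 1) * (d * (e + z) + 1) := by nlinarith
  nlinarith [abs_nonneg (y - z)]

lemma abs_cfPrefix_sub_le {a : ℕ → ℕ} (ha : ∀ i, 1 ≤ a i) (n : ℕ) {y z : ℝ}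
    (hy : y ∈ Set.Icc (0 : ℝ) 1) (hz : z ∈ Set.Icc (0 : ℝ) 1) :
    |cfPrefix n a y - cfPrefix n a z| ≤ 2 * (1 / 2) ^ n := by
  induction n using Nat.twoStepInduction generalizing a with
  | zero =>
    simp only [cfPrefix, pow_zero]
    rw [abs_le]; constructor <;> linarith [hy.1, hy.2, hz.1, hz.2]
  -- Only the trivial bound 1 is available here; the factor 2 in the statement pays for it.
  | one =>
    have h1 := cfPrefix_mem ha 1 hy
    have h2 := cfPrefix_mem ha 1 hz
    rw [abs_le]; constructor <;> linarith [h1.1, h1.2, h2.1, h2.2]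
  | more n ih _ =>
    have := ih (dropTerms_pos ha 2)
    have h := abs_one_div_add_sub_le (ha 0) (dropTerms_pos ha 1 0)
      (cfPrefix_mem (dropTerms_pos ha 2) n hy) (cfPrefix_mem (dropTerms_pos ha 2) n hz)
    simp only [cfPrefix, dropTerms_dropTerms]
    refine h.trans ?_
    rw [pow_add]
    linarith

lemma cauchySeq_cfPrefix {a : ℕ → ℕ} (ha : ∀ i, 1 ≤ a i) :
    CauchySeq fun n => cfPrefix n a 0 := by
  have h01 : (0 : ℝ) ∈ Set.Icc (0 : ℝ) 1 := by simp
  refine cauchySeq_of_le_geometric (1 / 2) 2 (by norm_num) fun n => ?_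
  rw [Real.dist_eq, cfPrefix_add]
  exact abs_cfPrefix_sub_le ha n h01 (cfPrefix_mem (dropTerms_pos ha n) 1 h01)

lemma tendsto_cfPrefix {a : ℕ → ℕ} (ha : ∀ i, 1 ≤ a i) :
    Filter.Tendsto (fun n => cfPrefix n a 0) Filter.atTop (nhds (cfValue a)) :=
  (cauchySeq_cfPrefix ha).tendsto_limUnder

lemma cfValue_mem_Icc {a : ℕ → ℕ} (ha : ∀ i, 1 ≤ a i) : cfValue a ∈ Set.Icc (0 : ℝ) 1 :=
  isClosed_Icc.mem_of_tendsto (tendsto_cfPrefix ha)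
    (Filter.Eventually.of_forall fun n => cfPrefix_mem ha n (by simp))

lemma cfValue_eq {a : ℕ → ℕ} (ha : ∀ i, 1 ≤ a i) :
    cfValue a = 1 / (a 0 + cfValue (dropTerms 1 a)) := by
  have h1 : (1 : ℝ) ≤ a 0 := by exact_mod_cast ha 0
  have h0 := (cfValue_mem_Icc (dropTerms_pos ha 1)).1
  refine tendsto_nhds_unique ((Filter.tendsto_add_atTop_iff_nat 1).2 (tendsto_cfPrefix ha)) ?_
  exact Filter.Tendsto.div tendsto_const_nhds
    (tendsto_const_nhds.add (tendsto_cfPrefix (dropTerms_pos ha 1))) (by linarith)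

lemma cfValue_pos {a : ℕ → ℕ} (ha : ∀ i, 1 ≤ a i) : 0 < cfValue a := by
  rw [cfValue_eq ha]
  have h1 : (1 : ℝ) ≤ a 0 := by exact_mod_cast ha 0
  have h0 := (cfValue_mem_Icc (dropTerms_pos ha 1)).1
  positivity

lemma cfValue_le_one_div {a : ℕ → ℕ} (ha : ∀ i, 1 ≤ a i) : cfValue a ≤ 1 / a 0 := by
  rw [cfValue_eq ha]
  have h1 : (1 : ℝ) ≤ a 0 := by exact_mod_cast ha 0
  have h0 := (cfValue_mem_Icc (dropTerms_pos ha 1)).1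
  exact one_div_le_one_div_of_le (by linarith) (by linarith)

lemma cfValue_eq_cfPrefix {a : ℕ → ℕ} (ha : ∀ i, 1 ≤ a i) (n : ℕ) :
    cfValue a = cfPrefix n a (cfValue (dropTerms n a)) := by
  induction n generalizing a with
  | zero =>
    have : dropTerms 0 a = a := by funext i; simp [dropTerms]
    simp [cfPrefix, this]
  | succ n ih =>
    rw [cfValue_eq ha, ih (dropTerms_pos ha 1), dropTerms_dropTerms, add_comm 1 n]
    rfl

lemma cfPrefix_congr {a b : ℕ → ℕ} {n : ℕ} (h : ∀ i < n, a i = b i) (z : ℝ) :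
    cfPrefix n a z = cfPrefix n b z := by
  induction n generalizing a b with
  | zero => rfl
  | succ n ih =>
    simp only [cfPrefix]
    rw [h 0 (by omega), ih (a := dropTerms 1 a) (b := dropTerms 1 b)]
    intro i hi
    exact h _ (by omega)

lemma abs_cfValue_sub_cfPrefix_le {a b : ℕ → ℕ} (ha : ∀ i, 1 ≤ a i) {n : ℕ}
    (h : ∀ i < n, a i = b i) {z : ℝ} (hz : z ∈ Set.Icc (0 : ℝ) 1) :
    |cfValue a - cfPrefix n b z| ≤ 2 * (1 / 2) ^ n := by
  rw [cfValue_eq_cfPrefix ha n, ← cfPrefix_congr h]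
  exact abs_cfPrefix_sub_le ha n (cfValue_mem_Icc (dropTerms_pos ha n)) hz

lemma abs_cfValue_sub_le {a b : ℕ → ℕ} (ha : ∀ i, 1 ≤ a i) (hb : ∀ i, 1 ≤ b i) {n : ℕ}
    (h : ∀ i < n, a i = b i) : |cfValue a - cfValue b| ≤ 2 * (1 / 2) ^ n := by
  rw [cfValue_eq_cfPrefix hb n]
  exact abs_cfValue_sub_cfPrefix_le ha h (cfValue_mem_Icc (dropTerms_pos hb n))

/-! ### Convergents and the Dirichlet constant -/

/-- Denominators of the convergents of `[0; a 0, a 1, …]`, starting with `0, 1`. -/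
def cfDen (a : ℕ → ℕ) : ℕ → ℕ
  | 0 => 0
  | 1 => 1
  | n + 2 => a n * cfDen a (n + 1) + cfDen a n

/-- Numerators of the convergents of `[0; a 0, a 1, …]`, starting with `1, 0`. -/
def cfNum (a : ℕ → ℕ) : ℕ → ℕ
  | 0 => 1
  | 1 => 0
  | n + 2 => a n * cfNum a (n + 1) + cfNum a n

/-- The absolute error `|q_n α - p_n|` as a product of complete quotients. -/
noncomputable def cfError (a : ℕ → ℕ) (n : ℕ) : ℝ :=
  ∏ i ∈ Finset.range n, cfValue (dropTerms i a)

section Convergents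

variable {a : ℕ → ℕ}

lemma cfValue_dropTerms_mul (ha : ∀ i, 1 ≤ a i) (n : ℕ) :
    cfValue (dropTerms n a) * (a n + cfValue (dropTerms (n + 1) a)) = 1 := by
  have h1 : (1 : ℝ) ≤ a n := by exact_mod_cast ha n
  have h0 := (cfValue_mem_Icc (dropTerms_pos ha (n + 1))).1
  rw [cfValue_eq (dropTerms_pos ha n), dropTerms_dropTerms]
  exact one_div_mul_cancel (by simp only [dropTerms, add_zero]; linarith)

lemma cfError_pos (ha : ∀ i, 1 ≤ a i) (n : ℕ) : 0 < cfError a n :=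
  Finset.prod_pos fun _ _ => cfValue_pos (dropTerms_pos ha _)

lemma cfError_succ (n : ℕ) : cfError a (n + 1) = cfError a n * cfValue (dropTerms n a) :=
  Finset.prod_range_succ _ _

lemma cfDen_mul_sub_cfNum (ha : ∀ i, 1 ≤ a i) (n : ℕ) :
    (cfDen a n : ℝ) * cfValue a - cfNum a n = (-1) ^ (n + 1) * cfError a n := by
  induction n using Nat.twoStepInduction with
  | zero => simp [cfDen, cfNum, cfError]
  | one =>
    have : dropTerms 0 a = a := by funext i; simp [dropTerms]
    simp [cfDen, cfNum, cfError, this]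
  | more n ih1 ih2 =>
    have hx := cfValue_dropTerms_mul ha n
    simp only [cfDen, cfNum]
    rw [cfError_succ, cfError_succ] at *
    push_cast
    have : ((a n : ℝ) * cfDen a (n + 1) + cfDen a n) * cfValue a -
        (a n * cfNum a (n + 1) + cfNum a n) =
        a n * (cfDen a (n + 1) * cfValue a - cfNum a (n + 1)) +
          (cfDen a n * cfValue a - cfNum a n) := by ring
    rw [this, ih1, ih2]
    linear_combination (-1) ^ (n + 1) * cfError a n * (-1) * hx

lemma cfDen_pos (ha : ∀ i, 1 ≤ a i) (n : ℕ) : 1 ≤ cfDen a (n + 1) := by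
  induction n using Nat.twoStepInduction with
  | zero => simp [cfDen]
  | one => simpa [cfDen] using ha 0
  | more n ih1 _ => exact le_trans ih1 (Nat.le_add_left _ _)

lemma cfDen_mono (ha : ∀ i, 1 ≤ a i) : Monotone (cfDen a) := by
  refine monotone_nat_of_le_succ fun n => ?_
  cases n with
  | zero => simp [cfDen]
  | succ n =>
    simp only [cfDen]
    nlinarith [ha n]

lemma le_cfDen_add_one (ha : ∀ i, 1 ≤ a i) (n : ℕ) : n ≤ cfDen a n + 1 := by
  induction n with
  | zero => simp
  | succ n ih =>
    match n with
    | 0 => simp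
    | 1 => have := cfDen_pos ha 1; omega
    | n + 2 =>
      have h1 := cfDen_pos ha n
      have h2 : 1 * cfDen a (n + 2) ≤ a (n + 1) * cfDen a (n + 2) :=
        Nat.mul_le_mul_right _ (ha (n + 1))
      simp only [cfDen] at *
      omega

lemma tendsto_cfDen (ha : ∀ i, 1 ≤ a i) : Filter.Tendsto (cfDen a) Filter.atTop Filter.atTop :=
  Filter.tendsto_atTop_mono (fun n => (by have := le_cfDen_add_one ha n; omega : n - 1 ≤ cfDen a n))
    (Filter.tendsto_sub_atTop_nat 1)

/-- The unimodularity of consecutive convergents, read off with errors in place of numerators; the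
recurrence leaves the sum unchanged. -/
lemma cfDen_mul_cfError_add (ha : ∀ i, 1 ≤ a i) (n : ℕ) :
    (cfDen a (n + 1) : ℝ) * cfError a n + cfDen a n * cfError a (n + 1) = 1 := by
  induction n with
  | zero => simp [cfDen, cfError]
  | succ n ih =>
    have hx := cfValue_dropTerms_mul ha n
    simp only [cfDen]
    rw [cfError_succ (n + 1)]
    rw [cfError_succ] at *
    push_cast
    linear_combination ih + (cfDen a (n + 1) : ℝ) * cfError a n * hx

lemma cfDen_mul_cfError_le_one (ha : ∀ i, 1 ≤ a i) (n : ℕ) :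
    (cfDen a (n + 1) : ℝ) * cfError a n ≤ 1 := by
  have := cfDen_mul_cfError_add ha n
  have : 0 ≤ (cfDen a n : ℝ) * cfError a (n + 1) :=
    mul_nonneg (by positivity) (cfError_pos ha _).le
  linarith

lemma cfNum_mul_cfDen_sub (n : ℕ) :
    (cfNum a n : ℤ) * cfDen a (n + 1) - cfNum a (n + 1) * cfDen a n = (-1) ^ n := by
  induction n with
  | zero => simp [cfDen, cfNum]
  | succ n ih =>
    simp only [cfDen, cfNum]
    push_cast
    rw [pow_succ]
    linear_combination (-1) * ih

/-- Best approximation. Consecutive convergents form a lattice basis, so (q, p) has integer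
coordinates u, v in it. The bounds on q force u ≠ 0 and forbid u, v of equal sign. As the two errors
alternate in sign, the contributions add up and leave at least |u| times the larger error. -/
lemma cfError_le_abs_sub (ha : ∀ i, 1 ≤ a i) {n q : ℕ} (hq : 1 ≤ q) (hqn : q < cfDen a (n + 1))
    (p : ℤ) : cfError a n ≤ |(q : ℝ) * cfValue a - p| := by
  obtain ⟨u, v, hu, hv⟩ : ∃ u v : ℤ, (q : ℤ) = u * cfDen a n + v * cfDen a (n + 1) ∧
      p = u * cfNum a n + v * cfNum a (n + 1) := by
    have hdet := cfNum_mul_cfDen_sub (a := a) n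
    have hsq : ((-1 : ℤ) ^ n) * (-1) ^ n = 1 := by rw [← mul_pow]; simp
    refine ⟨(-1) ^ n * (p * cfDen a (n + 1) - q * cfNum a (n + 1)),
      (-1) ^ n * (q * cfNum a n - p * cfDen a n), ?_, ?_⟩
    · linear_combination (-1) * (q : ℤ) * hsq - (-1) ^ n * (q : ℤ) * hdet
    · linear_combination (-1) * (p : ℤ) * hsq - (-1) ^ n * (p : ℤ) * hdet
  have e1 := cfDen_mul_sub_cfNum ha n
  have e2 := cfDen_mul_sub_cfNum ha (n + 1)
  have hur : (q : ℝ) = u * cfDen a n + v * cfDen a (n + 1) := by exact_mod_cast hu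
  have hvr : (p : ℝ) = u * cfNum a n + v * cfNum a (n + 1) := by exact_mod_cast hv
  have d0 := cfError_pos ha n
  have d1 := cfError_pos ha (n + 1)
  have key : (q : ℝ) * cfValue a - p =
      (-1) ^ (n + 1) * (u * cfError a n - v * cfError a (n + 1)) := by
    rw [hur, hvr]
    rw [pow_succ] at e2
    linear_combination (u : ℝ) * e1 + (v : ℝ) * e2
  rw [key, abs_mul, abs_pow, abs_neg, abs_one, one_pow, one_mul]
  have hQ := cfDen_pos ha n
  have hQ0 : (0 : ℤ) ≤ cfDen a n := by positivity
  have hQ1 : (1 : ℤ) ≤ cfDen a (n + 1) := by exact_mod_cast hQ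
  have hq' : (1 : ℤ) ≤ q := by exact_mod_cast hq
  have hqn' : (q : ℤ) < cfDen a (n + 1) := by exact_mod_cast hqn
  rcases lt_trichotomy u 0 with h | h | h
  · have hv0 : 0 ≤ v := by
      by_contra hc
      push Not at hc
      nlinarith
    have h1 : (u : ℝ) ≤ -1 := by exact_mod_cast (by omega : u ≤ -1)
    have h2 : (0 : ℝ) ≤ v := by exact_mod_cast hv0
    rw [abs_of_nonpos (by nlinarith)]
    nlinarith
  · subst h
    exfalso
    rcases le_or_gt v 0 with hv0 | hv0 <;> nlinarith
  · have hv0 : v ≤ 0 := by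
      by_contra hc
      push Not at hc
      nlinarith
    have h1 : (1 : ℝ) ≤ u := by exact_mod_cast h
    have h2 : (v : ℝ) ≤ 0 := by exact_mod_cast hv0
    rw [abs_of_nonneg (by nlinarith)]
    nlinarith

lemma irrational_cfValue (ha : ∀ i, 1 ≤ a i) : Irrational (cfValue a) := by
  rintro ⟨r, hr⟩
  obtain ⟨n, hn⟩ := ((tendsto_cfDen ha).eventually_gt_atTop r.den).exists
  have h := cfError_le_abs_sub ha (n := n) r.pos
    (hn.trans_le (cfDen_mono ha (Nat.le_succ n))) r.num
  have hr' : (r.den : ℝ) * cfValue a - r.num = 0 := by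
    rw [← hr, sub_eq_zero]
    exact_mod_cast Rat.den_mul_eq_num r
  rw [hr', abs_zero] at h
  exact absurd h (not_le.2 (cfError_pos ha n))

end Convergents

/-! ### The measure function between consecutive denominators -/

lemma distNearestInt_eq (x : ℝ) : distNearestInt x = |x - round x| :=
  (abs_sub_round_eq_min x).symm

lemma distNearestInt_nonneg (x : ℝ) : 0 ≤ distNearestInt x := by
  rw [distNearestInt_eq]; positivity

lemma irrationalityMeasureFun_nonneg (α t : ℝ) : 0 ≤ irrationalityMeasureFun α t :=
  Real.sInf_nonneg (by rintro _ ⟨q, -, rfl⟩; exact distNearestInt_nonneg _)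

lemma irrationalityMeasureFun_le_cfError {a : ℕ → ℕ} (ha : ∀ i, 1 ≤ a i) {n : ℕ} {t : ℝ}
    (ht : (cfDen a (n + 1) : ℝ) ≤ t) :
    irrationalityMeasureFun (cfValue a) t ≤ cfError a (n + 1) := by
  have h1 : irrationalityMeasureFun (cfValue a) t ≤
      distNearestInt (cfDen a (n + 1) * cfValue a) :=
    csInf_le ⟨0, by rintro _ ⟨q, -, rfl⟩; exact distNearestInt_nonneg _⟩
      ⟨cfDen a (n + 1), ⟨cfDen_pos ha n, ht⟩, rfl⟩
  refine h1.trans ?_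
  rw [distNearestInt_eq]
  refine (round_le _ (cfNum a (n + 1) : ℤ)).trans ?_
  have := cfDen_mul_sub_cfNum ha (n + 1)
  push_cast
  rw [this, abs_mul, abs_pow, abs_neg, abs_one, one_pow, one_mul, abs_of_pos (cfError_pos ha _)]

lemma cfError_le_irrationalityMeasureFun {a : ℕ → ℕ} (ha : ∀ i, 1 ≤ a i) {n : ℕ} {t : ℝ}
    (h1 : 1 ≤ t) (ht : t < cfDen a (n + 1)) :
    cfError a n ≤ irrationalityMeasureFun (cfValue a) t := by
  refine le_csInf ⟨_, 1, ⟨le_rfl, by simpa using h1⟩, rfl⟩ ?_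
  rintro _ ⟨q, ⟨hq1, hqt⟩, rfl⟩
  simp only [distNearestInt_eq]
  exact cfError_le_abs_sub ha hq1 (by exact_mod_cast hqt.trans_lt ht) _

/-- On the interval between two consecutive denominators ψ is constant, so t ψ(t) grows linearly and
its supremum there is the right denominator times the constant error. -/
lemma dirichletConstant_cfValue_eq {a : ℕ → ℕ} (ha : ∀ i, 1 ≤ a i) {L : ℝ}
    (hle : ∀ ε > 0, ∀ᶠ n in Filter.atTop, (cfDen a (n + 1) : ℝ) * cfError a n ≤ L + ε)
    (hge : ∀ ε > 0, ∃ᶠ n in Filter.atTop, L - ε ≤ (cfDen a (n + 1) : ℝ) * cfError a n) :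
    dirichletConstant (cfValue a) = L := by
  have hev : ∀ ε > 0, ∀ᶠ t : ℝ in Filter.atTop,
      t * irrationalityMeasureFun (cfValue a) t ≤ L + ε := by
    intro ε hε
    obtain ⟨N, hN⟩ := Filter.eventually_atTop.1 (hle ε hε)
    filter_upwards [Filter.eventually_ge_atTop (cfDen a (N + 1) : ℝ),
      Filter.eventually_ge_atTop (0 : ℝ)] with t ht ht0
    have hex : ∃ n, t < cfDen a (n + 1) := by
      obtain ⟨m, hm⟩ := exists_nat_gt t
      obtain ⟨n, hn⟩ := ((tendsto_cfDen ha).eventually_ge_atTop m).exists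
      refine ⟨n, hm.trans_le ?_⟩
      exact_mod_cast hn.trans (cfDen_mono ha (Nat.le_succ n))
    classical
    obtain ⟨n, hn, hmin⟩ : ∃ n, t < cfDen a (n + 1) ∧ ∀ m < n, ¬ t < cfDen a (m + 1) :=
      ⟨Nat.find hex, Nat.find_spec hex, fun m hm => Nat.find_min hex hm⟩
    have hNn : N < n := by
      by_contra hc
      have : (cfDen a (n + 1) : ℝ) ≤ cfDen a (N + 1) := by
        exact_mod_cast cfDen_mono ha (by omega)
      linarith
    obtain ⟨m, rfl⟩ : ∃ m, n = m + 1 := ⟨n - 1, by omega⟩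
    have h1 := irrationalityMeasureFun_le_cfError ha (not_lt.1 (hmin m (by omega)))
    calc t * irrationalityMeasureFun (cfValue a) t
        ≤ cfDen a (m + 1 + 1) * cfError a (m + 1) :=
          mul_le_mul hn.le h1 (irrationalityMeasureFun_nonneg _ _) (by positivity)
      _ ≤ L + ε := hN _ (by omega)
  have hfr : ∀ ε > 0, ∃ᶠ t : ℝ in Filter.atTop,
      L - ε ≤ t * irrationalityMeasureFun (cfValue a) t := by
    intro ε hε
    rw [Filter.frequently_atTop]
    intro T
    obtain ⟨m, hm⟩ := exists_nat_gt (max (max T 1) (2 / ε) + 1)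
    have hbig : ∀ᶠ n in Filter.atTop, m ≤ cfDen a (n + 1) :=
      ((Filter.tendsto_add_atTop_iff_nat 1).2 (tendsto_cfDen ha)).eventually_ge_atTop m
    obtain ⟨n, hn, hnm⟩ := ((hge (ε / 2) (by positivity)).and_eventually hbig).exists
    have hnm' : (m : ℝ) ≤ cfDen a (n + 1) := by exact_mod_cast hnm
    have hQ : max (max T 1) (2 / ε) + 1 < cfDen a (n + 1) := hm.trans_le hnm'
    have hT : T ≤ max (max T 1) (2 / ε) := (le_max_left _ _).trans (le_max_left _ _)
    have h1 : 1 ≤ max (max T 1) (2 / ε) := (le_max_right _ _).trans (le_max_left _ _)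
    have h2 : 2 / ε ≤ max (max T 1) (2 / ε) := le_max_right _ _
    have h1' : (1 : ℝ) ≤ cfDen a (n + 1) - 1 := by linarith
    -- ψ drops at the denominator itself, so t stops one unit before it. The loss is a single
    -- `cfError a n`, at most ε / 2 because the denominator exceeds 2 / ε.
    refine ⟨cfDen a (n + 1) - 1, by linarith, ?_⟩
    have h3 := cfError_le_irrationalityMeasureFun ha (n := n) h1' (by linarith)
    have h4 := cfDen_mul_cfError_le_one ha n
    have h5 : cfError a n ≤ ε / 2 := by
      have h6 : 2 / ε * cfError a n ≤ 1 :=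
        (mul_le_mul_of_nonneg_right (by linarith) (cfError_pos ha n).le).trans h4
      rw [div_mul_eq_mul_div, div_le_one hε] at h6
      linarith
    nlinarith
  have hbdd : Filter.IsBoundedUnder (· ≤ ·) Filter.atTop
      fun t : ℝ => t * irrationalityMeasureFun (cfValue a) t := ⟨L + 1, hev 1 one_pos⟩
  have hcob : Filter.IsCoboundedUnder (· ≤ ·) Filter.atTop
      fun t : ℝ => t * irrationalityMeasureFun (cfValue a) t :=
    Filter.isCoboundedUnder_le_of_eventually_le _ (x := 0) (by
      filter_upwards [Filter.eventually_ge_atTop (0 : ℝ)] with t ht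
      exact mul_nonneg ht (irrationalityMeasureFun_nonneg _ _))
  refine le_antisymm ?_ ?_
  · refine le_of_forall_pos_le_add fun ε hε => ?_
    exact Filter.limsup_le_of_le hcob (hev ε hε)
  · refine le_of_forall_pos_le_add fun ε hε => ?_
    have := Filter.le_limsup_of_frequently_le (hfr ε hε) hbdd
    unfold dirichletConstant
    linarith

lemma dirichletConstant_nonneg (α : ℝ) : 0 ≤ dirichletConstant α := by
  rw [dirichletConstant, Filter.limsup_eq]
  refine Real.sInf_nonneg fun x hx => ?_
  obtain ⟨t, ht, h0⟩ := (Filter.Eventually.and hx (Filter.eventually_ge_atTop (0 : ℝ))).exists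
  exact (mul_nonneg h0 (irrationalityMeasureFun_nonneg _ _)).trans ht

/-! ### The Dirichlet constant through products of two-sided continued fractions -/

/-- The terms `a n, a (n - 1), …, a 0, a 0, …` read backwards. -/
def backTerms (n : ℕ) (a : ℕ → ℕ) : ℕ → ℕ := fun i => a (n - i)

/-- The product `[a n; a (n - 1), …] * [a (n + 1); a (n + 2), …]`. -/
noncomputable def cutProduct (a : ℕ → ℕ) (n : ℕ) : ℝ :=
  (a n + cfValue (backTerms (n - 1) a)) * (a (n + 1) + cfValue (dropTerms (n + 2) a))

section CutProduct

variable {a : ℕ → ℕ}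

lemma backTerms_pos (ha : ∀ i, 1 ≤ a i) (n : ℕ) : ∀ i, 1 ≤ backTerms n a i := fun _ => ha _

lemma dropTerms_one_backTerms (n : ℕ) : dropTerms 1 (backTerms n a) = backTerms (n - 1) a := by
  funext i
  simp only [dropTerms, backTerms]
  congr 1
  omega

lemma cfDen_div_cfDen_succ (ha : ∀ i, 1 ≤ a i) (n : ℕ) :
    (cfDen a n : ℝ) / cfDen a (n + 1) = cfPrefix n (backTerms (n - 1) a) 0 := by
  induction n with
  | zero => simp [cfDen, cfPrefix]
  | succ n ih =>
    have h1 : (0 : ℝ) < cfDen a (n + 1) := by exact_mod_cast cfDen_pos ha n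
    have h2 : (0 : ℝ) < cfDen a (n + 2) := by exact_mod_cast cfDen_pos ha (n + 1)
    simp only [cfPrefix, Nat.add_sub_cancel]
    rw [dropTerms_one_backTerms, ← ih]
    simp only [cfDen, backTerms, Nat.sub_zero] at h2 ⊢
    push_cast at h2 ⊢
    field_simp

/-- With X and Y the two factors, the identity `cfDen_mul_cfError_add` has summands in the ratio XY
: 1, and the left side here is the larger summand. -/
lemma cfDen_mul_cfError_eq (ha : ∀ i, 1 ≤ a i) (n : ℕ) :
    (cfDen a (n + 2) : ℝ) * cfError a (n + 1) =
      (a n + cfDen a n / cfDen a (n + 1)) * (a (n + 1) + cfValue (dropTerms (n + 2) a)) /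
        ((a n + cfDen a n / cfDen a (n + 1)) * (a (n + 1) + cfValue (dropTerms (n + 2) a)) + 1) := by
  have h1 : (0 : ℝ) < cfDen a (n + 1) := by exact_mod_cast cfDen_pos ha n
  have hx := cfValue_dropTerms_mul ha (n + 1)
  have hs := cfDen_mul_cfError_add ha (n + 1)
  rw [cfError_succ (n + 1)] at hs
  have hxp := cfValue_pos (dropTerms_pos ha (n + 1))
  have hyp := cfValue_pos (dropTerms_pos ha (n + 2))
  have hX : (a n + cfDen a n / cfDen a (n + 1) : ℝ) * cfDen a (n + 1) = cfDen a (n + 2) := by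
    simp only [cfDen]; push_cast; field_simp
  have hXp : (0 : ℝ) < a n + cfDen a n / cfDen a (n + 1) := by
    have : (1 : ℝ) ≤ a n := by exact_mod_cast ha n
    positivity
  rw [← hX] at hs ⊢
  generalize (a n + cfDen a n / cfDen a (n + 1) : ℝ) = X at *
  rw [eq_div_iff (by positivity)]
  rw [show n + 1 + 1 = n + 2 from rfl] at *
  linear_combination X * (a (n + 1) + cfValue (dropTerms (n + 2) a)) * hs -
    X * cfDen a (n + 1) * cfError a (n + 1) * hx

lemma div_add_one_le_div_add_one {x y : ℝ} (hx : 0 ≤ x) (hxy : x ≤ y) :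
    x / (x + 1) ≤ y / (y + 1) := by
  rw [div_le_div_iff₀ (by linarith) (by linarith)]
  nlinarith

lemma add_div_add_one_le {x ε : ℝ} (hx : 0 ≤ x) (hε : 0 ≤ ε) :
    (x + ε) / (x + ε + 1) ≤ x / (x + 1) + ε := by
  rw [div_add' _ _ _ (by positivity), div_le_div_iff₀ (by positivity) (by positivity)]
  nlinarith [mul_nonneg hx hε, mul_nonneg (mul_nonneg hx hx) hε, mul_nonneg hx (mul_nonneg hε hε),
    mul_nonneg hε hε]

/-- `cutProduct` replaces the finite reversed fraction by an infinite one that repeats `a 0`. The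
two agree in n terms, and K bounds the other factor. -/
lemma abs_sub_cutProduct_le (ha : ∀ i, 1 ≤ a i) {K : ℕ} (hK : ∀ i, a i ≤ K) (n : ℕ) :
    |(a n + cfDen a n / cfDen a (n + 1)) * (a (n + 1) + cfValue (dropTerms (n + 2) a)) -
      cutProduct a n| ≤ 2 * (K + 1) * (1 / 2) ^ n := by
  have h1 := abs_cfValue_sub_cfPrefix_le (backTerms_pos ha (n - 1)) (n := n) (fun i _ => rfl)
    (z := 0) (by simp)
  rw [← cfDen_div_cfDen_succ ha] at h1
  have hY := cfValue_mem_Icc (dropTerms_pos ha (n + 2))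
  have hK' : (a (n + 1) : ℝ) ≤ K := by exact_mod_cast hK _
  have hY1 : 0 ≤ (a (n + 1) : ℝ) + cfValue (dropTerms (n + 2) a) :=
    add_nonneg (by positivity) hY.1
  rw [cutProduct, ← sub_mul, abs_mul, add_sub_add_left_eq_sub, abs_sub_comm, abs_of_nonneg hY1]
  calc _ ≤ 2 * (1 / 2) ^ n * ((K : ℝ) + 1) :=
        mul_le_mul h1 (by linarith [hY.2]) hY1 (by positivity)
    _ = _ := by ring

lemma dirichletConstant_cfValue_of_cutProduct (ha : ∀ i, 1 ≤ a i) {K : ℕ} (hK : ∀ i, a i ≤ K)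
    {M : ℝ} (hM : 0 < M)
    (hle : ∀ ε > 0, ∀ᶠ n in Filter.atTop, cutProduct a n ≤ M + ε)
    (hge : ∀ ε > 0, ∃ᶠ n in Filter.atTop, M - ε ≤ cutProduct a n) :
    dirichletConstant (cfValue a) = M / (M + 1) := by
  have hlim : Filter.Tendsto (fun n : ℕ => 2 * ((K : ℝ) + 1) * (1 / 2) ^ n) Filter.atTop
      (nhds 0) := by
    simpa using (tendsto_pow_atTop_nhds_zero_of_lt_one (r := (1 / 2 : ℝ)) (by norm_num)
      (by norm_num)).const_mul (2 * ((K : ℝ) + 1))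
  have hP : ∀ n, 0 ≤ (a n + cfDen a n / cfDen a (n + 1) : ℝ) *
      (a (n + 1) + cfValue (dropTerms (n + 2) a)) := fun n =>
    mul_nonneg (by positivity) (add_nonneg (by positivity) (cfValue_pos (dropTerms_pos ha _)).le)
  refine dirichletConstant_cfValue_eq ha (fun ε hε => ?_) fun ε hε => ?_
  · suffices h : ∀ᶠ n in Filter.atTop,
        (cfDen a (n + 2) : ℝ) * cfError a (n + 1) ≤ M / (M + 1) + ε by
      obtain ⟨N, hN⟩ := Filter.eventually_atTop.1 h
      refine Filter.eventually_atTop.2 ⟨N + 1, fun n hn => ?_⟩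
      obtain ⟨m, rfl⟩ : ∃ m, n = m + 1 := ⟨n - 1, by omega⟩
      exact hN m (by omega)
    filter_upwards [hlim.eventually_le_const (half_pos hε), hle _ (half_pos hε)] with n hn hn'
    rw [cfDen_mul_cfError_eq ha]
    have h1 := (abs_le.1 (abs_sub_cutProduct_le ha hK n)).2
    exact (div_add_one_le_div_add_one (hP n) (by linarith)).trans
      (add_div_add_one_le hM.le hε.le)
  · have hδ : 0 < min (ε / 2) (M / 2) := by positivity
    have h := (hge _ hδ).and_eventually (hlim.eventually_le_const hδ)
    rw [Filter.frequently_atTop] at h ⊢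
    intro N
    obtain ⟨n, hn, h2, h3⟩ := h N
    refine ⟨n + 1, by omega, ?_⟩
    rw [cfDen_mul_cfError_eq ha]
    have h1 := (abs_le.1 (abs_sub_cutProduct_le ha hK n)).1
    have h4 := min_le_left (ε / 2) (M / 2)
    have h5 := min_le_right (ε / 2) (M / 2)
    generalize min (ε / 2) (M / 2) = δ at *
    have h6 := add_div_add_one_le (x := M - 2 * δ) (ε := 2 * δ) (by linarith) (by linarith)
    have h7 : (M - 2 * δ) / (M - 2 * δ + 1) ≤ _ :=
      div_add_one_le_div_add_one (x := M - 2 * δ) (by linarith) (by linarith :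
        M - 2 * δ ≤ (a n + cfDen a n / cfDen a (n + 1) : ℝ) *
          (a (n + 1) + cfValue (dropTerms (n + 2) a)))
    rw [sub_add_cancel] at h6
    linarith

end CutProduct

/-- Terms tending to infinity make the products X tend to infinity, hence X/(X+1) to 1. -/
lemma one_mem_dirichletSpectrum : (1 : ℝ) ∈ dirichletSpectrum := by
  set a : ℕ → ℕ := fun n => n + 1 with ha_def
  have ha : ∀ i, 1 ≤ a i := fun i => Nat.le_add_left _ _
  refine ⟨cfValue a, irrational_cfValue ha, (dirichletConstant_cfValue_eq ha ?_ ?_).symm⟩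
  · intro ε hε
    exact Filter.Eventually.of_forall fun n => by linarith [cfDen_mul_cfError_le_one ha n]
  · intro ε hε
    refine Filter.Eventually.frequently ?_
    obtain ⟨N, hN⟩ := exists_nat_gt (1 / ε)
    refine Filter.eventually_atTop.2 ⟨N + 1, fun n hn => ?_⟩
    obtain ⟨m, rfl⟩ : ∃ m, n = m + 1 := ⟨n - 1, by omega⟩
    rw [cfDen_mul_cfError_eq ha]
    have hy := cfValue_pos (dropTerms_pos ha (m + 2))
    have hm : (N : ℝ) ≤ m := by exact_mod_cast (by omega : N ≤ m)
    have hm' : 1 / ε < m := hN.trans_le hm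
    have hP : (m : ℝ) ≤ (a m + cfDen a m / cfDen a (m + 1)) *
        (a (m + 1) + cfValue (dropTerms (m + 2) a)) := by
      have h1 : (m : ℝ) + 1 ≤ a m + cfDen a m / cfDen a (m + 1) := by
        have : (0 : ℝ) ≤ cfDen a m / cfDen a (m + 1) := by positivity
        simp only [ha_def] at this ⊢
        push_cast
        linarith
      have h2 : (1 : ℝ) ≤ a (m + 1) + cfValue (dropTerms (m + 2) a) := by
        have : (1 : ℝ) ≤ a (m + 1) := by exact_mod_cast ha _
        linarith
      nlinarith [Nat.cast_nonneg (α := ℝ) m]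
    refine le_trans ?_ (div_add_one_le_div_add_one (Nat.cast_nonneg m) hP)
    rw [le_div_iff₀ (by positivity)]
    rw [div_lt_iff₀ hε] at hm'
    nlinarith

/-! ### Upper bounds for continued fractions avoiding the word `41414` -/

/-- The word `41414` does not occur. -/
def AvoidsWord (e : ℕ → ℕ) : Prop :=
  ∀ i, ¬(e i = 4 ∧ e (i + 1) = 1 ∧ e (i + 2) = 4 ∧ e (i + 3) = 1 ∧ e (i + 4) = 4)

/-- All terms lie between `1` and `4`. -/
def TermsLeFour (e : ℕ → ℕ) : Prop := ∀ i, 1 ≤ e i ∧ e i ≤ 4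

/-- The largest value `[4; 1, 4, 1, 3, 1, 4, 1, 4, 1, 3, 1, …]` of a continued fraction with
terms at most `4` avoiding `41414`. -/
noncomputable def extremalValue : ℝ := (117 + Real.sqrt 26565) / 58

/-- The value `[0; 1, 4, 1, 4, 1, 3, 1, 4, 1, 4, 1, 3, …]`. -/
noncomputable def extremalTail : ℝ := extremalValue / (extremalValue + 1)

lemma extremalValue_sq : 29 * extremalValue ^ 2 = 117 * extremalValue + 111 := by
  have := Real.sq_sqrt (show (0 : ℝ) ≤ 26565 by norm_num)
  unfold extremalValue
  linear_combination (29 / 58 ^ 2 : ℝ) * this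

lemma lt_extremalValue : 4.827 < extremalValue := by
  have : (162.98 : ℝ) < Real.sqrt 26565 := Real.lt_sqrt_of_sq_lt (by norm_num)
  unfold extremalValue
  linarith

lemma extremalTail_eq : extremalTail = 1 / (1 + 1 / (4 + (extremalValue - 4))) := by
  have := lt_extremalValue
  unfold extremalTail
  rw [add_sub_cancel]
  field_simp

lemma extremalTail_mem : extremalTail ∈ Set.Icc (0.828 : ℝ) 1 := by
  have := lt_extremalValue
  unfold extremalTail
  constructor
  · rw [le_div_iff₀ (by linarith)]; linarith
  · rw [div_le_one (by linarith)]; linarith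

/-- One turn of the periodic expansion. With `extremalTail_eq` it makes the upper bounds below
reproduce themselves. -/
lemma extremalValue_sub_four_eq :
    extremalValue - 4 = 1 / (1 + 1 / (4 + 1 / (1 + 1 / (3 + extremalTail)))) := by
  have h1 := lt_extremalValue
  have h2 := extremalValue_sq
  unfold extremalTail
  generalize extremalValue = x at *
  have e1 : 3 + x / (x + 1) = (4 * x + 3) / (x + 1) := by field_simp; ring
  have e2 : 1 / (1 + 1 / ((4 * x + 3) / (x + 1))) = (4 * x + 3) / (5 * x + 4) := by
    field_simp; ring
  have e3 : 1 / (1 + 1 / (4 + (4 * x + 3) / (5 * x + 4))) = (24 * x + 19) / (29 * x + 23) := by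
    field_simp; ring
  rw [e1, e2, e3, eq_div_iff (by linarith)]
  linear_combination h2

lemma one_div_add_one_div_le_add {d e y z η : ℝ} (hd : 1 ≤ d) (he : 1 ≤ e) (hy : 0 ≤ y)
    (hz : 0 ≤ z) (hη : 0 ≤ η) (h : y ≤ z + η) :
    1 / (d + 1 / (e + y)) ≤ 1 / (d + 1 / (e + z)) + η / 4 := by
  have key : 1 / (d + 1 / (e + y)) - 1 / (d + 1 / (e + z)) =
      (y - z) / ((d * (e + y) + 1) * (d * (e + z) + 1)) := by
    field_simp; ring
  have a1 : 1 ≤ d * (e + y) := by nlinarith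
  have a2 : 1 ≤ d * (e + z) := by nlinarith
  have a3 : 4 ≤ (d * (e + y) + 1) * (d * (e + z) + 1) := by nlinarith
  have : (y - z) / ((d * (e + y) + 1) * (d * (e + z) + 1)) ≤ η / 4 := by
    rw [div_le_div_iff₀ (by positivity) (by norm_num)]
    nlinarith
  linarith

lemma AvoidsWord.dropTerms {e : ℕ → ℕ} (h : AvoidsWord e) (n : ℕ) :
    AvoidsWord (dropTerms n e) := fun i => h (n + i)

lemma TermsLeFour.dropTerms {e : ℕ → ℕ} (h : TermsLeFour e) (n : ℕ) :
    TermsLeFour (dropTerms n e) := fun i => h (n + i)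

lemma TermsLeFour.pos {e : ℕ → ℕ} (h : TermsLeFour e) : ∀ i, 1 ≤ e i := fun i => (h i).1

/-- The value is at most `4 / 5` unless the continued fraction starts with `1, 4`. -/
lemma TermsLeFour.cfValue_le_or {e : ℕ → ℕ} (h : TermsLeFour e) :
    cfValue e ≤ 4 / 5 ∨ (e 0 = 1 ∧ e 1 = 4 ∧
      cfValue e = 1 / (1 + 1 / (4 + cfValue (_root_.dropTerms 2 e)))) := by
  have hp := h.pos
  have hz := cfValue_mem_Icc (dropTerms_pos hp 2)
  have e1 := cfValue_eq hp
  have e2 := cfValue_eq (dropTerms_pos hp 1)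
  rw [dropTerms_dropTerms] at e2
  rw [e2] at e1
  have hd : _root_.dropTerms 1 e 0 = e 1 := rfl
  rw [hd] at e1
  by_cases h0 : e 0 = 1
  · by_cases h1 : e 1 = 4
    · right
      refine ⟨h0, h1, ?_⟩
      rw [e1, h0, h1]
      norm_num
    · left
      have h3 : (e 1 : ℝ) ≤ 3 := by exact_mod_cast (by have := h 1; omega : e 1 ≤ 3)
      have h1' : (1 : ℝ) ≤ e 1 := by exact_mod_cast hp 1
      have : (1 : ℝ) / 4 ≤ 1 / (e 1 + cfValue (_root_.dropTerms (1 + 1) e)) :=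
        one_div_le_one_div_of_le (by linarith [hz.1]) (by linarith [hz.2])
      rw [e1, h0]
      calc _ ≤ 1 / (1 + (1 : ℝ) / 4) := by
            apply one_div_le_one_div_of_le (by norm_num)
            push_cast
            linarith
        _ = 4 / 5 := by norm_num
  · left
    have h2 : (2 : ℝ) ≤ e 0 := by exact_mod_cast (by have := h 0; omega : 2 ≤ e 0)
    have := cfValue_le_one_div hp
    have h3 : 1 / (e 0 : ℝ) ≤ 1 / 2 := one_div_le_one_div_of_le (by norm_num) h2
    linarith

/-- The hypothesis `h4` is what avoiding 41414 gives for a tail preceded by 4. To be large the tail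
must start 1, 4, and then 1, at most 3. Beyond that the inductive bound applies, and its excess η
only shrinks. -/
lemma cfValue_le_extremal_aux {η : ℝ} (hη : 0 ≤ η)
    (hind : ∀ e : ℕ → ℕ, TermsLeFour e → AvoidsWord e → cfValue e ≤ extremalTail + η)
    {e : ℕ → ℕ} (he : TermsLeFour e) (hw : AvoidsWord e)
    (h4 : ¬(e 0 = 1 ∧ e 1 = 4 ∧ e 2 = 1 ∧ e 3 = 4)) :
    cfValue e ≤ extremalValue - 4 + η := by
  have hθ := lt_extremalValue
  rcases he.cfValue_le_or with h | ⟨h0, h1, h⟩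
  · linarith
  have hp := (he.dropTerms 2).pos
  have hz := cfValue_mem_Icc hp
  have hS := extremalTail_mem
  by_cases h2 : e 2 = 1
  · have h3 : e 3 ≤ 3 := by have := he 3; omega
    have hz4 := cfValue_mem_Icc (dropTerms_pos he.pos 4)
    have hle : cfValue (dropTerms 2 e) ≤ 1 / (1 + 1 / (3 + cfValue (dropTerms 4 e))) := by
      rw [cfValue_eq hp, cfValue_eq (dropTerms_pos hp 1)]
      simp only [dropTerms_dropTerms]
      simp only [dropTerms, add_zero, h2]
      have h31 : (1 : ℝ) ≤ e 3 := by exact_mod_cast he.pos 3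
      have h3' : (e 3 : ℝ) ≤ 3 := by exact_mod_cast h3
      have hz4' := hz4.1
      have : 1 / (3 + cfValue (dropTerms 4 e)) ≤ 1 / (e 3 + cfValue (dropTerms 4 e)) :=
        one_div_le_one_div_of_le (by linarith) (by linarith)
      have hpos : 0 < 1 / (3 + cfValue (dropTerms 4 e)) := by positivity
      push_cast
      exact one_div_le_one_div_of_le (by linarith) (by simpa [dropTerms] using this)
    have hb := one_div_add_one_div_le_add (d := 1) (e := 3) le_rfl (by norm_num) hz4.1
      (by linarith [hS.1]) hη (hind _ (he.dropTerms 4) (hw.dropTerms 4))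
    have hp1 : 0 ≤ 1 / (1 + 1 / (3 + extremalTail)) := by
      have := hS.1
      positivity
    have hc := one_div_add_one_div_le_add (d := 1) (e := 4) le_rfl (by norm_num) hz.1
      hp1 (η := η / 4) (by linarith) (by linarith)
    rw [← extremalValue_sub_four_eq] at hc
    rw [h]
    linarith
  -- Here the value is at most 1/(1 + 1/(4 + 1/2)) = 9/11, already below 0.827.
  · have h22 : (2 : ℝ) ≤ e 2 := by exact_mod_cast (by have := he 2; omega : 2 ≤ e 2)
    have h3 := cfValue_le_one_div hp
    have h5 : 1 / ((dropTerms 2 e 0 : ℕ) : ℝ) ≤ 1 / 2 :=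
      one_div_le_one_div_of_le (by norm_num) h22
    have := one_div_add_one_div_le_add (d := 1) (e := 4) (z := 1 / 2) (η := 0) le_rfl
      (by norm_num) hz.1 (by norm_num) le_rfl (by linarith)
    norm_num at this
    rw [h]
    norm_num
    linarith

/-- The excess over the extremal value is at most 1 to begin with, and stripping the prefix 1, 4
gains a factor 1/4 each time. -/
lemma cfValue_le_extremalTail {e : ℕ → ℕ} (he : TermsLeFour e) (hw : AvoidsWord e) :
    cfValue e ≤ extremalTail := by
  have hS := extremalTail_mem
  have key : ∀ n : ℕ, ∀ e : ℕ → ℕ, TermsLeFour e → AvoidsWord e →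
      cfValue e ≤ extremalTail + (1 / 4) ^ n := by
    intro n
    induction n with
    | zero =>
      intro e he _
      have := (cfValue_mem_Icc he.pos).2
      simp only [pow_zero]
      linarith [hS.1]
    | succ n ih =>
      intro e he hw
      have hpow : (0 : ℝ) ≤ (1 / 4) ^ n := by positivity
      rcases he.cfValue_le_or with h | ⟨-, h1, h⟩
      · rw [pow_succ]
        linarith [hS.1]
      · have hz := cfValue_mem_Icc (he.dropTerms 2).pos
        have h4 : ¬(dropTerms 2 e 0 = 1 ∧ dropTerms 2 e 1 = 4 ∧ dropTerms 2 e 2 = 1 ∧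
            dropTerms 2 e 3 = 4) := fun ⟨a, b, c, d⟩ => hw 1 ⟨h1, a, b, c, d⟩
        have := cfValue_le_extremal_aux hpow ih (he.dropTerms 2) (hw.dropTerms 2) h4
        have hb := one_div_add_one_div_le_add (d := 1) (e := 4) le_rfl (by norm_num) hz.1
          (by linarith [lt_extremalValue]) hpow this
        rw [← extremalTail_eq] at hb
        rw [h, pow_succ]
        linarith
  have hlim : Filter.Tendsto (fun n : ℕ => extremalTail + (1 / 4 : ℝ) ^ n) Filter.atTop
      (nhds extremalTail) := by
    simpa using (tendsto_pow_atTop_nhds_zero_of_lt_one (r := (1 / 4 : ℝ)) (by norm_num)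
      (by norm_num)).const_add extremalTail
  exact ge_of_tendsto' hlim fun n => key n e he hw

lemma cfValue_le_extremalValue_sub_four {e : ℕ → ℕ} (he : TermsLeFour e) (hw : AvoidsWord e)
    (h4 : ¬(e 0 = 1 ∧ e 1 = 4 ∧ e 2 = 1 ∧ e 3 = 4)) : cfValue e ≤ extremalValue - 4 := by
  simpa using cfValue_le_extremal_aux le_rfl
    (fun e he hw => by simpa using cfValue_le_extremalTail he hw) he hw h4

/-- The word is a palindrome. A window running past the end of the reversed sequence would end in
the repeated term `e 0`, which is not 4. -/
lemma AvoidsWord.backTerms {e : ℕ → ℕ} (hw : AvoidsWord e) (h0 : e 0 ≠ 4) (n : ℕ) :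
    AvoidsWord (backTerms n e) := by
  rintro i ⟨h1, h2, h3, h4, h5⟩
  simp only [_root_.backTerms] at *
  by_cases hn : i + 4 ≤ n
  · obtain ⟨j, rfl⟩ : ∃ j, n = j + (i + 4) := ⟨n - (i + 4), by omega⟩
    refine hw j ⟨?_, ?_, ?_, ?_, ?_⟩
    · rw [← h5]; congr 1; omega
    · rw [← h4]; congr 1; omega
    · rw [← h3]; congr 1; omega
    · rw [← h2]; congr 1; omega
    · rw [← h1]; congr 1; omega
  · rw [show n - (i + 4) = 0 by omega] at h5
    exact h0 h5

/-- Each factor is at most `extremalValue`. Since the pair is not 44, one factor has leading term at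
most 3 and is bounded by 3 + `extremalTail`. -/
lemma cutProduct_le_extremal {c : ℕ → ℕ} (hc : TermsLeFour c) (hw : AvoidsWord c)
    (h0 : c 0 ≠ 4) {n : ℕ} (h44 : ¬(c n = 4 ∧ c (n + 1) = 4)) :
    cutProduct c n ≤ (3 + extremalTail) * extremalValue := by
  have hb4 : ∀ m, TermsLeFour (backTerms m c) := fun m i => hc _
  have hS := extremalTail_mem
  have hθ := lt_extremalValue
  have hxm := cfValue_mem_Icc (hb4 (n - 1)).pos
  have hym := cfValue_mem_Icc (hc.dropTerms (n + 2)).pos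
  have hx := cfValue_le_extremalTail (hb4 (n - 1)) (hw.backTerms h0 (n - 1))
  have hy := cfValue_le_extremalTail (hc.dropTerms (n + 2)) (hw.dropTerms (n + 2))
  have hx4 : (c n : ℝ) + cfValue (backTerms (n - 1) c) ≤ extremalValue := by
    by_cases h : c n = 4
    · have := cfValue_le_extremalValue_sub_four (hb4 (n - 1)) (hw.backTerms h0 (n - 1))
        (by
          have h1 := hw.backTerms h0 n 0
          simp only [backTerms] at h1 ⊢
          simp only [Nat.sub_sub, Nat.sub_zero, zero_add, Nat.reduceAdd, h] at h1 ⊢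
          tauto)
      rw [h]
      push_cast
      linarith
    · have : (c n : ℝ) ≤ 3 := by exact_mod_cast (by have := hc n; omega : c n ≤ 3)
      linarith [hS.2]
  have hy4 : (c (n + 1) : ℝ) + cfValue (dropTerms (n + 2) c) ≤ extremalValue := by
    by_cases h : c (n + 1) = 4
    · have := cfValue_le_extremalValue_sub_four (hc.dropTerms (n + 2)) (hw.dropTerms (n + 2))
        (fun ⟨a, b, c, d⟩ => hw (n + 1) ⟨h, a, b, c, d⟩)
      rw [h]
      push_cast
      linarith
    · have : (c (n + 1) : ℝ) ≤ 3 := by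
        exact_mod_cast (by have := hc (n + 1); omega : c (n + 1) ≤ 3)
      linarith [hS.2]
  have hx0 : 0 ≤ (c n : ℝ) + cfValue (backTerms (n - 1) c) := add_nonneg (by positivity) hxm.1
  have hy0 : 0 ≤ (c (n + 1) : ℝ) + cfValue (dropTerms (n + 2) c) :=
    add_nonneg (by positivity) hym.1
  rw [cutProduct]
  by_cases h : c n ≤ 3
  · have : (c n : ℝ) ≤ 3 := by exact_mod_cast h
    exact mul_le_mul (by linarith) hy4 hy0 (by linarith [hS.1])
  · have h' : c (n + 1) ≤ 3 := by have := hc n; have := hc (n + 1); omega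
    have : (c (n + 1) : ℝ) ≤ 3 := by exact_mod_cast h'
    rw [mul_comm (3 + extremalTail)]
    exact mul_le_mul hx4 (by linarith) hy0 (by linarith)

/-! ### Sequences with prescribed central pairs -/

/-- The `m`-th term of the block `2, u (k - 2), …, u 0, p, q, v 0, …, v (k - 2)`. -/
def blockTerm (p q : ℕ) (u v : ℕ → ℕ) (k m : ℕ) : ℕ :=
  if m = 0 then 2 else if m < k then u (k - 1 - m) else if m = k then p else
    if m = k + 1 then q else v (m - k - 2)

/-- The concatenation of the blocks `blockTerm p q u v k`, the `k`-th of length `2 * k + 1`. -/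
def blockSeq (p q : ℕ) (u v : ℕ → ℕ) (n : ℕ) : ℕ :=
  blockTerm p q u v n.sqrt (n - n.sqrt * n.sqrt)

/-- The sequence `d, u 0, u 1, …`. -/
def consTerm (d : ℕ) (u : ℕ → ℕ) : ℕ → ℕ
  | 0 => d
  | i + 1 => u i

/-- A tail admissible next to a central term: its terms are at most `4`, and with a `4` put in
front it contains neither `44` nor `41414`. -/
structure AdmissibleTail (u : ℕ → ℕ) : Prop where
  terms : TermsLeFour u
  not_four_four : ∀ i, ¬(consTerm 4 u i = 4 ∧ consTerm 4 u (i + 1) = 4)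
  avoids : AvoidsWord (consTerm 4 u)

section Blocks

variable {p q : ℕ} {u v : ℕ → ℕ}

/-- Block k fills the positions from k² to k² + 2k, so `Nat.sqrt` finds the block. -/
lemma blockSeq_eq {k m : ℕ} (h : m ≤ 2 * k) :
    blockSeq p q u v (k * k + m) = blockTerm p q u v k m := by
  have : (k * k + m).sqrt = k := Nat.sqrt_add_eq k (by omega)
  rw [blockSeq, this, Nat.add_sub_cancel_left]

lemma exists_block (n : ℕ) : ∃ k m, m ≤ 2 * k ∧ n = k * k + m := by
  have h1 := Nat.sqrt_le n
  have h2 := Nat.sqrt_le_add n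
  exact ⟨n.sqrt, n - n.sqrt * n.sqrt, by omega, by omega⟩

lemma blockSeq_start (k : ℕ) : blockSeq p q u v (k * k) = 2 := by
  simpa [blockTerm] using blockSeq_eq (p := p) (q := q) (u := u) (v := v) (k := k) (m := 0)
    (by omega)

lemma blockSeq_next {k m i : ℕ} (h : m + i = 2 * k + 1) :
    blockSeq p q u v (k * k + m + i) = 2 := by
  rw [← blockSeq_start (p := p) (q := q) (u := u) (v := v) (k + 1)]
  congr 1
  nlinarith

lemma blockTerm_left {k i : ℕ} (h : i + 1 < k) : blockTerm p q u v k (k - 1 - i) = u i := by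
  rw [blockTerm, if_neg (by omega), if_pos (by omega), show k - 1 - (k - 1 - i) = i by omega]

lemma blockTerm_center {k : ℕ} (h : 1 ≤ k) : blockTerm p q u v k k = p := by
  rw [blockTerm, if_neg (by omega), if_neg (by omega), if_pos rfl]

lemma blockTerm_center_succ {k : ℕ} : blockTerm p q u v k (k + 1) = q := by
  simp [blockTerm]

lemma blockTerm_right {k i : ℕ} : blockTerm p q u v k (k + 2 + i) = v i := by
  rw [blockTerm, if_neg (by omega), if_neg (by omega), if_neg (by omega), if_neg (by omega),
    show k + 2 + i - k - 2 = i by omega]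

lemma blockTerm_zero {k : ℕ} : blockTerm p q u v k 0 = 2 := by simp [blockTerm]

lemma blockTerm_cases {k m : ℕ} (h : m ≤ 2 * k) :
    m = 0 ∨ (∃ i, i + 1 < k ∧ m = k - 1 - i) ∨ (m = k ∧ 1 ≤ k) ∨ (m = k + 1 ∧ 1 ≤ k) ∨
      ∃ i, i + 2 ≤ k ∧ m = k + 2 + i := by
  rcases Nat.eq_zero_or_pos m with h0 | h0
  · exact Or.inl h0
  rcases lt_trichotomy m k with h1 | h1 | h1
  · exact Or.inr (Or.inl ⟨k - 1 - m, by omega, by omega⟩)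
  · exact Or.inr (Or.inr (Or.inl ⟨h1, by omega⟩))
  · rcases Nat.eq_or_lt_of_le (Nat.succ_le_of_lt h1) with h2 | h2
    · exact Or.inr (Or.inr (Or.inr (Or.inl ⟨h2.symm, by omega⟩)))
    · exact Or.inr (Or.inr (Or.inr (Or.inr ⟨m - k - 2, by omega, by omega⟩)))

lemma blockSeq_cases (hu : TermsLeFour u) (hv : TermsLeFour v) (n : ℕ) :
    (1 ≤ blockSeq p q u v n ∧ blockSeq p q u v n ≤ 4) ∨ blockSeq p q u v n = p ∨
      blockSeq p q u v n = q := by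
  obtain ⟨k, m, hm, rfl⟩ := exists_block n
  rw [blockSeq_eq hm]
  rcases blockTerm_cases hm with rfl | ⟨i, hi, rfl⟩ | ⟨rfl, hk⟩ | ⟨rfl, hk⟩ | ⟨i, hi, rfl⟩
  · rw [blockTerm_zero]; omega
  · rw [blockTerm_left hi]; exact Or.inl (hu i)
  · rw [blockTerm_center hk]; omega
  · rw [blockTerm_center_succ]; omega
  · rw [blockTerm_right]; exact Or.inl (hv i)

lemma AdmissibleTail.head_le (hu : AdmissibleTail u) : u 0 ≤ 3 := by
  have h1 := hu.terms 0
  have h2 : ¬(4 = 4 ∧ u 0 = 4) := hu.not_four_four 0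
  omega

/-- The pairs of neighbours away from the central pairs. -/
lemma blockSeq_pair_cases (hu : AdmissibleTail u) (hv : AdmissibleTail v) (n : ℕ) :
    (∃ k, 1 ≤ k ∧ n = k * k + k) ∨
    (blockSeq p q u v n ≤ 4 ∧ blockSeq p q u v (n + 1) ≤ 4 ∧
      ¬(blockSeq p q u v n = 4 ∧ blockSeq p q u v (n + 1) = 4)) ∨
    (blockSeq p q u v n ≤ 3 ∧ blockSeq p q u v (n + 1) = p ∧ blockSeq p q u v (n + 2) = q) ∨
    (1 ≤ n ∧ blockSeq p q u v (n - 1) = p ∧ blockSeq p q u v n = q ∧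
      blockSeq p q u v (n + 1) ≤ 3) := by
  have hu0 := hu.head_le
  have hv0 := hv.head_le
  obtain ⟨k, m, hm, rfl⟩ := exists_block n
  rcases eq_or_lt_of_le hm with hm2 | hm2
  · -- the right neighbour starts the next block
    have hn : blockSeq p q u v (k * k + m + 1) = 2 := blockSeq_next (by omega)
    rw [hn, blockSeq_eq hm]
    rcases blockTerm_cases hm with rfl | ⟨i, hi, rfl⟩ | ⟨rfl, hk⟩ | ⟨rfl, hk⟩ | ⟨i, hi, rfl⟩
    · rw [blockTerm_zero]; right; left; omega
    · omega
    · omega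
    · right; right; right
      rw [blockTerm_center_succ]
      refine ⟨by omega, ?_, rfl, by omega⟩
      rw [show k * k + (k + 1) - 1 = k * k + k by omega, blockSeq_eq (by omega),
        blockTerm_center hk]
    · rw [blockTerm_right]
      have := hv.terms i
      right; left; omega
  · have hm1 : m + 1 ≤ 2 * k := by omega
    rw [add_assoc (k * k) m 1, add_assoc (k * k) m 2, blockSeq_eq hm, blockSeq_eq hm1]
    rcases blockTerm_cases hm with rfl | ⟨i, hi, rfl⟩ | ⟨rfl, hk⟩ | ⟨rfl, hk⟩ | ⟨i, hi, rfl⟩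
    · rw [blockTerm_zero]
      rcases eq_or_lt_of_le (show 1 ≤ k by omega) with rfl | hk
      · right; right; left
        refine ⟨by omega, by simp [blockTerm], ?_⟩
        rw [blockSeq_eq (by omega)]
        simp [blockTerm]
      · rw [show 0 + 1 = k - 1 - (k - 2) by omega, blockTerm_left (by omega)]
        have := hu.terms (k - 2)
        right; left; omega
    · rw [blockTerm_left hi]
      rcases Nat.eq_zero_or_pos i with rfl | hi0
      · right; right; left
        refine ⟨hu0, ?_, ?_⟩
        · rw [show k - 1 - 0 + 1 = k by omega, blockTerm_center (by omega)]
        · rw [show k - 1 - 0 + 2 = k + 1 by omega, blockSeq_eq (by omega), blockTerm_center_succ]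
      · obtain ⟨i, rfl⟩ : ∃ j, i = j + 1 := ⟨i - 1, by omega⟩
        rw [show k - 1 - (i + 1) + 1 = k - 1 - i by omega, blockTerm_left (by omega)]
        have h1 := hu.terms i
        have h2 := hu.terms (i + 1)
        have h3 := hu.not_four_four (i + 1)
        simp only [consTerm] at h3
        right; left; omega
    · exact Or.inl ⟨m, hk, rfl⟩
    · right; right; right
      rw [blockTerm_center_succ, show k + 1 + 1 = k + 2 + 0 by omega, blockTerm_right]
      refine ⟨by omega, ?_, rfl, hv0⟩
      rw [show k * k + (k + 1) - 1 = k * k + k by omega, blockSeq_eq (by omega),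
        blockTerm_center hk]
    · rw [blockTerm_right, show k + 2 + i + 1 = k + 2 + (i + 1) by omega, blockTerm_right]
      have h1 := hv.terms i
      have h2 := hv.terms (i + 1)
      have h3 := hv.not_four_four (i + 1)
      simp only [consTerm] at h3
      right; left; omega

/-- A window crossing into the next block contains a separator 2. One that contains a central 4 in
its interior, or both of them, meets a 4 where a 1 is needed. The rest lies in u or v, possibly with
the adjacent central 4, and is excluded by admissibility (for u read backwards). -/
lemma avoidsWord_blockSeq (hu : AdmissibleTail u) (hv : AdmissibleTail v) :
    AvoidsWord (blockSeq 4 4 u v) := by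
  intro n
  obtain ⟨k, m, hm, rfl⟩ := exists_block n
  rintro ⟨h0, h1, h2, h3, h4⟩
  by_cases hm4 : m + 4 ≤ 2 * k
  · rw [add_assoc, blockSeq_eq (by omega)] at h1 h2 h3 h4
    rw [blockSeq_eq hm] at h0
    rcases blockTerm_cases hm with rfl | ⟨i, hi, rfl⟩ | ⟨rfl, hk⟩ | ⟨rfl, hk⟩ | ⟨i, hi, rfl⟩
    · rw [blockTerm_zero] at h0; omega
    · match i with
      | 0 =>
        rw [show k - 1 - 0 + 1 = k by omega, blockTerm_center (by omega)] at h1; omega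
      | 1 =>
        rw [show k - 1 - 1 + 3 = k + 1 by omega, blockTerm_center_succ] at h3; omega
      | 2 =>
        rw [show k - 1 - 2 + 3 = k by omega, blockTerm_center (by omega)] at h3; omega
      | 3 =>
        rw [blockTerm_left hi] at h0
        rw [show k - 1 - 3 + 1 = k - 1 - 2 by omega, blockTerm_left (by omega)] at h1
        rw [show k - 1 - 3 + 2 = k - 1 - 1 by omega, blockTerm_left (by omega)] at h2
        rw [show k - 1 - 3 + 3 = k - 1 - 0 by omega, blockTerm_left (by omega)] at h3
        exact hu.avoids 0 ⟨rfl, h3, h2, h1, h0⟩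
      | i + 4 =>
        rw [blockTerm_left hi] at h0
        rw [show k - 1 - (i + 4) + 1 = k - 1 - (i + 3) by omega, blockTerm_left (by omega)] at h1
        rw [show k - 1 - (i + 4) + 2 = k - 1 - (i + 2) by omega, blockTerm_left (by omega)] at h2
        rw [show k - 1 - (i + 4) + 3 = k - 1 - (i + 1) by omega, blockTerm_left (by omega)] at h3
        rw [show k - 1 - (i + 4) + 4 = k - 1 - i by omega, blockTerm_left (by omega)] at h4
        exact hu.avoids (i + 1) ⟨h4, h3, h2, h1, h0⟩
    · rw [blockTerm_center_succ] at h1; omega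
    · rw [show k + 1 + 1 = k + 2 + 0 by omega, blockTerm_right] at h1
      rw [show k + 1 + 2 = k + 2 + 1 by omega, blockTerm_right] at h2
      rw [show k + 1 + 3 = k + 2 + 2 by omega, blockTerm_right] at h3
      rw [show k + 1 + 4 = k + 2 + 3 by omega, blockTerm_right] at h4
      exact hv.avoids 0 ⟨rfl, h1, h2, h3, h4⟩
    · rw [add_assoc (k + 2), blockTerm_right] at h1 h2 h3 h4
      rw [blockTerm_right] at h0
      exact hv.avoids (i + 1) ⟨h0, h1, h2, h3, h4⟩
  · have hcase : m + 1 = 2 * k + 1 ∨ m + 2 = 2 * k + 1 ∨ m + 3 = 2 * k + 1 ∨ m + 4 = 2 * k + 1 := by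
      omega
    rcases hcase with h | h | h | h <;>
      have := blockSeq_next (p := 4) (q := 4) (u := u) (v := v) h <;> omega

lemma backTerms_blockSeq {k i : ℕ} (hi : i + 1 < k) :
    backTerms (k * k + k - 1) (blockSeq p q u v) i = u i := by
  rw [backTerms, show k * k + k - 1 - i = k * k + (k - 1 - i) by omega, blockSeq_eq (by omega),
    blockTerm_left hi]

lemma dropTerms_blockSeq {k i : ℕ} (hi : i + 1 < k) :
    dropTerms (k * k + k + 2) (blockSeq p q u v) i = v i := by
  rw [dropTerms, show k * k + k + 2 + i = k * k + (k + 2 + i) by omega, blockSeq_eq (by omega),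
    blockTerm_right]

/-- In block k + 1 the centre sees k terms of u on its left and k terms of v on its right. -/
lemma abs_cutProduct_blockSeq_sub_le (hc : ∀ i, 1 ≤ blockSeq p q u v i) (hu : ∀ i, 1 ≤ u i)
    (hv : ∀ i, 1 ≤ v i) (k : ℕ) :
    |cutProduct (blockSeq p q u v) ((k + 1) * (k + 1) + (k + 1)) -
      (p + cfValue u) * (q + cfValue v)| ≤ 2 * (p + q + 2) * (1 / 2) ^ k := by
  have hp : blockSeq p q u v ((k + 1) * (k + 1) + (k + 1)) = p := by
    rw [blockSeq_eq (by omega), blockTerm_center (by omega)]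
  have hq : blockSeq p q u v ((k + 1) * (k + 1) + (k + 1) + 1) = q := by
    rw [add_assoc, blockSeq_eq (by omega), blockTerm_center_succ]
  have h1 := abs_cfValue_sub_le (n := k) (backTerms_pos hc ((k + 1) * (k + 1) + (k + 1) - 1)) hu
    fun i hi => backTerms_blockSeq (by omega)
  have h2 := abs_cfValue_sub_le (n := k) (dropTerms_pos hc ((k + 1) * (k + 1) + (k + 1) + 2)) hv
    fun i hi => dropTerms_blockSeq (by omega)
  have hu' := cfValue_mem_Icc hu
  have hy := cfValue_mem_Icc (dropTerms_pos hc ((k + 1) * (k + 1) + (k + 1) + 2))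
  rw [cutProduct, hp, hq]
  generalize cfValue (backTerms _ _) = x at *
  generalize cfValue (dropTerms _ _) = y at *
  have hp0 : (0 : ℝ) ≤ p := by positivity
  have hq0 : (0 : ℝ) ≤ q := by positivity
  have e : (p + x) * (q + y) - (p + cfValue u) * (q + cfValue v) =
      (x - cfValue u) * (q + y) + (p + cfValue u) * (y - cfValue v) := by ring
  rw [e]
  refine (abs_add_le _ _).trans ?_
  rw [abs_mul, abs_mul, abs_of_nonneg (by linarith [hy.1] : 0 ≤ q + y),
    abs_of_nonneg (by linarith [hu'.1] : 0 ≤ p + cfValue u)]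
  have hpow : (0 : ℝ) ≤ 2 * (1 / 2) ^ k := by positivity
  have m1 := mul_le_mul h1 (by linarith [hy.2] : q + y ≤ q + 1) (by linarith [hy.1]) hpow
  have m2 := mul_le_mul (by linarith [hu'.2] : p + cfValue u ≤ p + 1) h2 (abs_nonneg _)
    (by linarith)
  linarith

/-- If the products at all other places are at most `M`, the central pairs determine the
Dirichlet constant. -/
lemma dirichletConstant_blockSeq (hc : ∀ i, 1 ≤ blockSeq p q u v i) (hu : ∀ i, 1 ≤ u i)
    (hv : ∀ i, 1 ≤ v i) {K : ℕ} (hK : ∀ i, blockSeq p q u v i ≤ K) {M : ℝ} (hM0 : 0 < M)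
    (hM : (p + cfValue u) * (q + cfValue v) = M)
    (hother : ∀ n, (∃ k, 1 ≤ k ∧ n = k * k + k) ∨ cutProduct (blockSeq p q u v) n ≤ M) :
    dirichletConstant (cfValue (blockSeq p q u v)) = M / (M + 1) := by
  have hlim : Filter.Tendsto (fun n : ℕ => 2 * ((p : ℝ) + q + 2) * (1 / 2) ^ n) Filter.atTop
      (nhds 0) := by
    simpa using (tendsto_pow_atTop_nhds_zero_of_lt_one (r := (1 / 2 : ℝ)) (by norm_num)
      (by norm_num)).const_mul (2 * ((p : ℝ) + q + 2))
  have happrox := abs_cutProduct_blockSeq_sub_le hc hu hv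
  rw [hM] at happrox
  refine dirichletConstant_cfValue_of_cutProduct hc hK hM0 (fun ε hε => ?_) fun ε hε => ?_
  · obtain ⟨N, hN⟩ := Filter.eventually_atTop.1 (hlim.eventually_le_const hε)
    refine Filter.eventually_atTop.2 ⟨(N + 2) * (N + 2), fun n hn => ?_⟩
    rcases hother n with ⟨k, hk, rfl⟩ | h
    · obtain ⟨k, rfl⟩ : ∃ j, k = j + 1 := ⟨k - 1, by omega⟩
      have hNk : N ≤ k := by
        by_contra hc
        nlinarith
      have h1 := (abs_le.1 (happrox k)).2
      linarith [hN k hNk]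
    · linarith
  · rw [Filter.frequently_atTop]
    intro N
    obtain ⟨k, hk, hkN⟩ :=
      ((hlim.eventually_le_const hε).and (Filter.eventually_ge_atTop N)).exists
    refine ⟨(k + 1) * (k + 1) + (k + 1), by nlinarith, ?_⟩
    have h1 := (abs_le.1 (happrox k)).1
    linarith

/-! ### Spectrum values produced by block sequences -/

lemma mem_dirichletSpectrum_of_extremal_le (hu : AdmissibleTail u) (hv : AdmissibleTail v)
    (hM : (3 + extremalTail) * extremalValue ≤ (4 + cfValue u) * (4 + cfValue v)) :
    (4 + cfValue u) * (4 + cfValue v) / ((4 + cfValue u) * (4 + cfValue v) + 1) ∈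
      dirichletSpectrum := by
  have hc : TermsLeFour (blockSeq 4 4 u v) := fun n => by
    have := blockSeq_cases (p := 4) (q := 4) hu.terms hv.terms n
    omega
  have hu0 := cfValue_pos hu.terms.pos
  have hv0 := cfValue_pos hv.terms.pos
  refine ⟨_, irrational_cfValue hc.pos, (dirichletConstant_blockSeq hc.pos hu.terms.pos
    hv.terms.pos (fun i => (hc i).2) (by positivity) (by push_cast; rfl) fun n => ?_).symm⟩
  rcases blockSeq_pair_cases (p := 4) (q := 4) hu hv n with h | h
  · exact Or.inl h
  · right
    refine (cutProduct_le_extremal hc (avoidsWord_blockSeq hu hv) ?_ ?_).trans hM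
    · have := blockSeq_start (p := 4) (q := 4) (u := u) (v := v) 0
      norm_num at this
      omega
    · omega

/-- Pairs of terms at most 4, other than 44, give products at most 4 * 5 = 20. A pair with exactly
one central term gives at most 4 (p + 1/4) or 4 (q + 1/4), below the central product because both
tails are at least 1/4. -/
lemma mem_dirichletSpectrum_of_large (hp : 4 ≤ p) (hq : 4 ≤ q) (hu : AdmissibleTail u)
    (hv : AdmissibleTail v) (hM : 20 ≤ (p + cfValue u) * (q + cfValue v))
    (hu4 : 1 / 4 ≤ cfValue u) (hv4 : 1 / 4 ≤ cfValue v) :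
    (p + cfValue u) * (q + cfValue v) / ((p + cfValue u) * (q + cfValue v) + 1) ∈
      dirichletSpectrum := by
  have hc : ∀ n, 1 ≤ blockSeq p q u v n := fun n => by
    have := blockSeq_cases (p := p) (q := q) hu.terms hv.terms n
    omega
  have hK : ∀ n, blockSeq p q u v n ≤ p + q := fun n => by
    have := blockSeq_cases (p := p) (q := q) hu.terms hv.terms n
    omega
  have hp' : (4 : ℝ) ≤ p := by exact_mod_cast hp
  have hq' : (4 : ℝ) ≤ q := by exact_mod_cast hq
  refine ⟨_, irrational_cfValue hc, (dirichletConstant_blockSeq hc hu.terms.pos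
    hv.terms.pos hK (by linarith) rfl fun n => ?_).symm⟩
  have hx := cfValue_mem_Icc (backTerms_pos hc (n - 1))
  have hx1 := cfValue_le_one_div (backTerms_pos hc (n - 1))
  have hy := cfValue_mem_Icc (dropTerms_pos hc (n + 2))
  have hy1 := cfValue_le_one_div (dropTerms_pos hc (n + 2))
  rcases blockSeq_pair_cases (p := p) (q := q) hu hv n with
    h | ⟨h1, h2, h3⟩ | ⟨h1, h2, h3⟩ | ⟨h0, h1, h2, h3⟩
  · exact Or.inl h
  · right
    refine le_trans ?_ hM
    rw [cutProduct]
    have hn0 : (0 : ℝ) ≤ blockSeq p q u v n := by positivity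
    have hn1 : (0 : ℝ) ≤ blockSeq p q u v (n + 1) := by positivity
    have h1' : (blockSeq p q u v n : ℝ) ≤ 4 := by exact_mod_cast h1
    have h2' : (blockSeq p q u v (n + 1) : ℝ) ≤ 4 := by exact_mod_cast h2
    by_cases h : blockSeq p q u v n ≤ 3
    · have h' : (blockSeq p q u v n : ℝ) ≤ 3 := by exact_mod_cast h
      exact (mul_le_mul (b := (4 : ℝ)) (d := 5) (by linarith [hx.2]) (by linarith [hy.2])
        (add_nonneg hn1 hy.1) (by norm_num)).trans (by norm_num)
    · have h' : (blockSeq p q u v (n + 1) : ℝ) ≤ 3 := by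
        exact_mod_cast (by omega : blockSeq p q u v (n + 1) ≤ 3)
      exact (mul_le_mul (b := (5 : ℝ)) (d := 4) (by linarith [hx.2]) (by linarith [hy.2])
        (add_nonneg hn1 hy.1) (by norm_num)).trans (by norm_num)
  · right
    have h1' : (blockSeq p q u v n : ℝ) ≤ 3 := by exact_mod_cast h1
    have e : dropTerms (n + 2) (blockSeq p q u v) 0 = q := h3
    rw [e] at hy1
    have hy2 : (1 : ℝ) / q ≤ 1 / 4 := one_div_le_one_div_of_le (by norm_num) hq'
    rw [cutProduct, h2]
    calc _ ≤ (4 : ℝ) * (p + 1 / 4) :=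
          mul_le_mul (by linarith [hx.2]) (by linarith) (add_nonneg (by positivity) hy.1)
            (by norm_num)
      _ ≤ _ := by nlinarith
  · right
    have h3' : (blockSeq p q u v (n + 1) : ℝ) ≤ 3 := by exact_mod_cast h3
    have e : backTerms (n - 1) (blockSeq p q u v) 0 = p := h1
    rw [e] at hx1
    have hx2 : (1 : ℝ) / p ≤ 1 / 4 := one_div_le_one_div_of_le (by norm_num) hp'
    rw [cutProduct, h2]
    calc _ ≤ (q + 1 / 4 : ℝ) * 4 :=
          mul_le_mul (by linarith) (by linarith [hy.2]) (add_nonneg (by positivity) hy.1)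
            (by positivity)
      _ ≤ _ := by nlinarith

end Blocks

/-! ### Sums of two Cantor sets given by binary trees of intervals -/

/-- A binary tree of intervals in which every gap is at most as long as the neighbouring
intervals, and gaps do not grow along branches. -/
structure GapTree (N : Type) where
  lo : N → ℝ
  hi : N → ℝ
  gap : N → ℝ
  child : N → Bool → N
  depth : N → ℕ
  gap_pos : ∀ n, 0 < gap n
  gap_le : ∀ n b, gap n ≤ hi (child n b) - lo (child n b)
  gap_child_le : ∀ n b, gap (child n b) ≤ gap n
  depth_lt : ∀ n b, depth n < depth (child n b)
  shrink : ∀ ε > 0, ∃ D, ∀ n, D ≤ depth n → gap n < ε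
  cover : ∀ n, ∀ x ∈ Set.Icc (lo n) (hi n),
    (∃ b, x ∈ Set.Icc (lo (child n b)) (hi (child n b))) ∨
    ∃ b b' x₁ x₂, x₁ ∈ Set.Icc (lo (child n b)) (hi (child n b)) ∧
      x₂ ∈ Set.Icc (lo (child n b')) (hi (child n b')) ∧ x₁ ≤ x ∧ x ≤ x₂ ∧ x₂ - x₁ ≤ gap n

namespace GapTree

variable {N₁ N₂ : Type}

/-- One node is a child of another. -/
def IsChild (T : GapTree N₁) (n n' : N₁) : Prop := ∃ b, n' = T.child n b

/-- Two nodes whose gaps fit into each other and whose intervals have a pair with sum `M`. -/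
def Linked (T₁ : GapTree N₁) (T₂ : GapTree N₂) (M : ℝ) (n : N₁) (m : N₂) : Prop :=
  T₁.gap n ≤ T₂.hi m - T₂.lo m ∧ T₂.gap m ≤ T₁.hi n - T₁.lo n ∧
    ∃ x ∈ Set.Icc (T₁.lo n) (T₁.hi n), M - x ∈ Set.Icc (T₂.lo m) (T₂.hi m)

variable {T₁ : GapTree N₁} {T₂ : GapTree N₂} {M : ℝ} {n : N₁} {m : N₂}

lemma Linked.symm (h : Linked T₁ T₂ M n m) : Linked T₂ T₁ M m n := by
  obtain ⟨h1, h2, x, hx, hy⟩ := h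
  exact ⟨h2, h1, M - x, hy, by rwa [sub_sub_cancel]⟩

/-- The interval with the larger gap is split. If x falls in the gap, then M - x₁ or M - x₂ lies in
the other interval, which is at least as long as the gap. The size conditions survive because each
child is at least as long as the gap of its parent. -/
lemma Linked.exists_child (h : Linked T₁ T₂ M n m) (hg : T₂.gap m ≤ T₁.gap n) :
    ∃ b, Linked T₁ T₂ M (T₁.child n b) m := by
  obtain ⟨h1, h2, x, hx, hy⟩ := h
  have key : ∀ b, ∀ x' ∈ Set.Icc (T₁.lo (T₁.child n b)) (T₁.hi (T₁.child n b)),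
      M - x' ∈ Set.Icc (T₂.lo m) (T₂.hi m) → ∃ b, Linked T₁ T₂ M (T₁.child n b) m :=
    fun b x' hx' hy' => ⟨b, (T₁.gap_child_le n b).trans h1, hg.trans (T₁.gap_le n b), x', hx', hy'⟩
  rcases T₁.cover n x hx with ⟨b, hb⟩ | ⟨b, b', x₁, x₂, hx₁, hx₂, hl, hr, hgap⟩
  · exact key b x hb hy
  · rcases le_or_gt (M - x₁) (T₂.hi m) with hc | hc
    · exact key b x₁ hx₁ ⟨by linarith [hy.1], hc⟩
    · exact key b' x₂ hx₂ ⟨by linarith, by linarith [hy.2]⟩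

/-- If the second node were never split, the gaps of the first would shrink below its gap, and then
it is the one to split. -/
lemma Linked.exists_desc_child (h : Linked T₁ T₂ M n m) :
    ∃ n' b, Relation.ReflTransGen T₁.IsChild n n' ∧ Linked T₁ T₂ M n' (T₂.child m b) := by
  by_contra hno
  push Not at hno
  have key : ∀ k : ℕ, ∃ n', Relation.ReflTransGen T₁.IsChild n n' ∧ k ≤ T₁.depth n' ∧
      Linked T₁ T₂ M n' m := by
    intro k
    induction k with
    | zero => exact ⟨n, Relation.ReflTransGen.refl, Nat.zero_le _, h⟩
    | succ k ih =>
      obtain ⟨n', hn', hk, hl⟩ := ih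
      rcases le_total (T₂.gap m) (T₁.gap n') with hg | hg
      · obtain ⟨b, hb⟩ := hl.exists_child hg
        exact ⟨_, hn'.tail ⟨b, rfl⟩, lt_of_le_of_lt hk (T₁.depth_lt n' b), hb⟩
      · obtain ⟨b, hb⟩ := hl.symm.exists_child hg
        exact absurd hb.symm (hno n' b hn')
  obtain ⟨D, hD⟩ := T₁.shrink _ (T₂.gap_pos m)
  obtain ⟨n', hn', hk, hl⟩ := key D
  obtain ⟨b, hb⟩ := hl.symm.exists_child (hD n' hk).le
  exact hno n' b hn' hb.symm

lemma Linked.exists_desc (h : Linked T₁ T₂ M n m) :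
    ∃ n' m', Relation.TransGen T₁.IsChild n n' ∧ Relation.TransGen T₂.IsChild m m' ∧
      Linked T₁ T₂ M n' m' := by
  obtain ⟨n₁, b, hn₁, h₁⟩ := h.exists_desc_child
  obtain ⟨m₂, b', hm₂, h₂⟩ := h₁.symm.exists_desc_child
  exact ⟨_, _, Relation.TransGen.tail' hn₁ ⟨b', rfl⟩, Relation.TransGen.head' ⟨b, rfl⟩ hm₂,
    h₂.symm⟩

lemma Linked.exists_seq (h : Linked T₁ T₂ M n m) :
    ∃ (f : ℕ → N₁) (g : ℕ → N₂), (∀ k, Relation.TransGen T₁.IsChild (f k) (f (k + 1))) ∧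
      (∀ k, Relation.TransGen T₂.IsChild (g k) (g (k + 1))) ∧
      ∀ k, Linked T₁ T₂ M (f k) (g k) := by
  choose F G hF hG hL using fun p : {p : N₁ × N₂ // Linked T₁ T₂ M p.1 p.2} => p.2.exists_desc
  let s : ℕ → {p : N₁ × N₂ // Linked T₁ T₂ M p.1 p.2} :=
    fun k => Nat.rec ⟨(n, m), h⟩ (fun _ p => ⟨(F p, G p), hL p⟩) k
  exact ⟨fun k => (s k).1.1, fun k => (s k).1.2, fun k => hF (s k), fun k => hG (s k),
    fun k => (s k).2⟩

lemma depth_lt_of_transGen {n n' : N₁} (h : Relation.TransGen T₁.IsChild n n') :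
    T₁.depth n < T₁.depth n' := by
  induction h with
  | single h => obtain ⟨b, rfl⟩ := h; exact T₁.depth_lt _ b
  | tail _ h ih => obtain ⟨b, rfl⟩ := h; exact ih.trans (T₁.depth_lt _ b)

end GapTree

/-! ### Lengths of cylinders on a logarithmic scale -/

/-- The derivative in `t` of `log (1 + t y) - log (1 + t x)`: the length of the image of `[x, y]`
under the Möbius map `z ↦ z / (1 + t z)`. -/
noncomputable def moebiusLength (t x y : ℝ) : ℝ := (y - x) / ((1 + t * x) * (1 + t * y))

/-- `log (1 + t y) - log (1 + t x)`. -/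
noncomputable def logRatio (x y t : ℝ) : ℝ := Real.log (1 + t * y) - Real.log (1 + t * x)

lemma hasDerivAt_logRatio {x y t : ℝ} (hx : 0 ≤ x) (hy : 0 ≤ y) (ht : 0 ≤ t) :
    HasDerivAt (logRatio x y) (moebiusLength t x y) t := by
  have h : ∀ z : ℝ, 0 ≤ z → HasDerivAt (fun t => Real.log (1 + t * z)) (z / (1 + t * z)) t := by
    intro z hz
    have h1 : HasDerivAt (fun t : ℝ => 1 + t * z) z t := by
      simpa using ((hasDerivAt_id t).mul_const z).const_add 1
    exact h1.log (by positivity)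
  have h1 := (h y hy).sub (h x hx)
  have e : moebiusLength t x y = y / (1 + t * y) - x / (1 + t * x) := by
    have : (0 : ℝ) < 1 + t * x := by positivity
    have : (0 : ℝ) < 1 + t * y := by positivity
    unfold moebiusLength
    field_simp
    ring
  rw [e]
  exact h1

lemma logRatio_mono {x y s t : ℝ} (hx : 0 ≤ x) (hxy : x ≤ y) (hs : 0 ≤ s) (hst : s ≤ t) :
    logRatio x y s ≤ logRatio x y t := by
  have hy := hx.trans hxy
  have ht := hs.trans hst
  have : MonotoneOn (logRatio x y) (Set.Ici 0) := by
    refine monotoneOn_of_deriv_nonneg (convex_Ici 0)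
      (fun t ht => (hasDerivAt_logRatio hx hy ht).continuousAt.continuousWithinAt)
      (fun t ht => ?_) fun t ht => ?_
    · rw [interior_Ici] at ht
      exact (hasDerivAt_logRatio hx hy (le_of_lt ht)).differentiableAt.differentiableWithinAt
    · rw [interior_Ici] at ht
      have ht0 : (0 : ℝ) < t := ht
      rw [(hasDerivAt_logRatio hx hy ht0.le).deriv, moebiusLength]
      have := sub_nonneg.2 hxy
      positivity
  exact this hs ht hst

lemma logRatio_sub_le {x y x' y' s t : ℝ} (hx : 0 ≤ x) (hxy : x ≤ y) (hx' : 0 ≤ x')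
    (hxy' : x' ≤ y') (hs : 0 ≤ s) (hst : s ≤ t)
    (h : ∀ τ ∈ Set.Icc s t, moebiusLength τ x y ≤ moebiusLength τ x' y') :
    logRatio x y t - logRatio x y s ≤ logRatio x' y' t - logRatio x' y' s := by
  have hy := hx.trans hxy
  have hy' := hx'.trans hxy'
  have hd : ∀ τ, 0 ≤ τ → HasDerivAt (fun τ => logRatio x' y' τ - logRatio x y τ)
      (moebiusLength τ x' y' - moebiusLength τ x y) τ := fun τ hτ =>
    (hasDerivAt_logRatio hx' hy' hτ).sub (hasDerivAt_logRatio hx hy hτ)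
  have : MonotoneOn (fun τ => logRatio x' y' τ - logRatio x y τ) (Set.Icc s t) := by
    refine monotoneOn_of_deriv_nonneg (convex_Icc s t)
      (fun τ hτ => (hd τ (hs.trans hτ.1)).continuousAt.continuousWithinAt)
      (fun τ hτ => ?_) fun τ hτ => ?_
    · exact (hd τ (hs.trans (interior_subset hτ).1)).differentiableAt.differentiableWithinAt
    · have hτ' := interior_subset hτ
      rw [(hd τ (hs.trans hτ'.1)).deriv]
      exact sub_nonneg.2 (h τ hτ')
  have h1 := this ⟨le_rfl, hst⟩ ⟨hst, le_rfl⟩ hst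
  simp only at h1
  linarith

/-- The increments of `logRatio` are integrals of `moebiusLength` over the parameter; absolute
values allow either order of s and t. -/
lemma abs_logRatio_sub_le_abs {x y x' y' s t a b : ℝ} (hx : 0 ≤ x) (hxy : x ≤ y) (hx' : 0 ≤ x')
    (hxy' : x' ≤ y') (ha : 0 ≤ a) (hs : s ∈ Set.Icc a b) (ht : t ∈ Set.Icc a b)
    (h : ∀ τ ∈ Set.Icc a b, moebiusLength τ x y ≤ moebiusLength τ x' y') :
    |logRatio x y t - logRatio x y s| ≤ |logRatio x' y' t - logRatio x' y' s| := by
  have hs0 := ha.trans hs.1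
  have ht0 := ha.trans ht.1
  rcases le_total s t with hst | hst
  · rw [abs_of_nonneg (sub_nonneg.2 (logRatio_mono hx hxy hs0 hst)),
      abs_of_nonneg (sub_nonneg.2 (logRatio_mono hx' hxy' hs0 hst))]
    exact logRatio_sub_le hx hxy hx' hxy' hs0 hst fun τ hτ =>
      h τ ⟨hs.1.trans hτ.1, hτ.2.trans ht.2⟩
  · rw [abs_of_nonpos (sub_nonpos.2 (logRatio_mono hx hxy ht0 hst)),
      abs_of_nonpos (sub_nonpos.2 (logRatio_mono hx' hxy' ht0 hst)), neg_sub, neg_sub]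
    exact logRatio_sub_le hx hxy hx' hxy' ht0 hst fun τ hτ =>
      h τ ⟨ht.1.trans hτ.1, hτ.2.trans hs.2⟩

lemma abs_logRatio_sub_le {x y s t : ℝ} (hx : 0 ≤ x) (hxy : x ≤ y) (hy : y ≤ 1) (hs : 0 ≤ s)
    (ht : 0 ≤ t) : |logRatio x y t - logRatio x y s| ≤ |t - s| := by
  have hy0 := hx.trans hxy
  have key : ∀ s t : ℝ, 0 ≤ s → s ≤ t → logRatio x y t - logRatio x y s ≤ t - s := by
    intro s t hs hst
    have ht := hs.trans hst
    have hd : ∀ τ, 0 ≤ τ → HasDerivAt (fun τ => τ - logRatio x y τ) (1 - moebiusLength τ x y) τ :=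
      fun τ hτ => (hasDerivAt_id τ).sub (hasDerivAt_logRatio hx hy0 hτ)
    have : MonotoneOn (fun τ => τ - logRatio x y τ) (Set.Icc s t) := by
      refine monotoneOn_of_deriv_nonneg (convex_Icc s t)
        (fun τ hτ => (hd τ (hs.trans hτ.1)).continuousAt.continuousWithinAt)
        (fun τ hτ => ?_) fun τ hτ => ?_
      · exact (hd τ (hs.trans (interior_subset hτ).1)).differentiableAt.differentiableWithinAt
      · have hτ0 := hs.trans (interior_subset hτ).1
        rw [(hd τ hτ0).deriv, moebiusLength, sub_nonneg, div_le_one (by positivity)]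
        have := mul_nonneg hτ0 hx
        have := mul_nonneg hτ0 hy0
        nlinarith
    have h1 := this ⟨le_rfl, hst⟩ ⟨hst, le_rfl⟩ hst
    simp only at h1
    linarith
  rcases le_total s t with hst | hst
  · rw [abs_of_nonneg (sub_nonneg.2 (logRatio_mono hx hxy hs hst)), abs_of_nonneg (by linarith)]
    exact key s t hs hst
  · rw [abs_of_nonpos (sub_nonpos.2 (logRatio_mono hx hxy ht hst)), abs_of_nonpos (by linarith)]
    linarith [key t s ht hst]

lemma logRatio_ne {x y s t : ℝ} (hx : 0 ≤ x) (hxy : x < y) (hs : 0 ≤ s) (ht : 0 ≤ t)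
    (hst : s ≠ t) : logRatio x y t ≠ logRatio x y s := by
  have hy := hx.trans hxy.le
  have p1 : 0 < 1 + t * x := by positivity
  have p2 : 0 < 1 + t * y := by positivity
  have p3 : 0 < 1 + s * x := by positivity
  have p4 : 0 < 1 + s * y := by positivity
  intro h
  unfold logRatio at h
  have h1 : Real.log ((1 + t * y) * (1 + s * x)) = Real.log ((1 + s * y) * (1 + t * x)) := by
    rw [Real.log_mul p2.ne' p3.ne', Real.log_mul p4.ne' p1.ne']
    linarith
  have h2 := Real.log_injOn_pos (Set.mem_Ioi.2 (mul_pos p2 p3)) (Set.mem_Ioi.2 (mul_pos p4 p1)) h1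
  have h3 : (t - s) * (y - x) = 0 := by linarith
  rcases mul_eq_zero.1 h3 with h | h
  · exact hst (by linarith)
  · linarith

/-! ### An automaton for admissible tails -/

/-- States of the automaton reading words without `44` and `41414`, named after the longest suffix
of the word that matters. -/
inductive TailState
  | free
  | four
  | fourOne
  | fourOneFour
  | fourOneFourOne

namespace TailState

/-- The state after reading one more term. -/
def next : TailState → ℕ → TailState
  | free, d => if d = 4 then four else free
  | four, d => if d = 1 then fourOne else free
  | fourOne, d => if d = 4 then fourOneFour else free
  | fourOneFour, d => if d = 1 then fourOneFourOne else free
  | fourOneFourOne, _ => free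

/-- The largest term allowed in a state. -/
def maxTerm : TailState → ℕ
  | free => 4
  | four => 3
  | fourOne => 4
  | fourOneFour => 3
  | fourOneFourOne => 3

/-- A number slightly above the least value of a tail. -/
noncomputable def minEnd : TailState → ℝ
  | free => 0.2073
  | four => 0.2613
  | fourOne => 0.2088
  | fourOneFour => 0.2613
  | fourOneFourOne => 0.2613

/-- A number slightly below the largest value of a tail. -/
noncomputable def maxEnd : TailState → ℝ
  | free => 0.8282
  | four => 0.8272
  | fourOne => 0.8282
  | fourOneFour => 0.7927
  | fourOneFourOne => 0.8282

/-- Lower bound for the ratios of consecutive denominators. -/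
noncomputable def ratioMin : TailState → ℝ
  | free => 1 / 4
  | four => 0
  | fourOne => 4 / 5
  | fourOneFour => 1 / 5
  | fourOneFourOne => 24 / 29

/-- Upper bound for the ratios of consecutive denominators. -/
noncomputable def ratioMax : TailState → ℝ
  | free => 1
  | four => 1 / 4
  | fourOne => 1
  | fourOneFour => 5 / 24
  | fourOneFourOne => 5 / 6

/-- Lower end of the interval of tails starting with `d`. -/
noncomputable def cylLow (s : TailState) (d : ℕ) : ℝ := 1 / (d + (s.next d).maxEnd)

/-- Upper end of the interval of tails starting with `d`. -/
noncomputable def cylHigh (s : TailState) (d : ℕ) : ℝ := 1 / (d + (s.next d).minEnd)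

/-- Upper end of the interval of tails starting with a term larger than `j`. -/
noncomputable def topEnd (s : TailState) (j : ℕ) : ℝ :=
  if j = 0 then s.maxEnd else s.cylHigh (j + 1)

lemma ratio_next {s : TailState} {d : ℕ} (h1 : 1 ≤ d) (hd : d ≤ s.maxTerm) {t : ℝ}
    (ht : t ∈ Set.Icc s.ratioMin s.ratioMax) :
    1 / (d + t) ∈ Set.Icc (s.next d).ratioMin (s.next d).ratioMax := by
  obtain ⟨ht0, ht1⟩ := ht
  cases s <;> simp only [maxTerm] at hd <;> interval_cases d <;>
    norm_num [ratioMin, ratioMax, next] at ht0 ht1 ⊢ <;>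
    first
    | exact ⟨by rw [le_inv_comm₀] <;> linarith, by rw [inv_le_comm₀] <;> linarith⟩
    | exact ⟨by linarith, by rw [inv_le_comm₀] <;> linarith⟩

lemma minEnd_pos (s : TailState) : 0 < s.minEnd := by cases s <;> norm_num [minEnd]

lemma minEnd_lt_maxEnd (s : TailState) : s.minEnd < s.maxEnd := by
  cases s <;> norm_num [minEnd, maxEnd]

lemma maxEnd_pos (s : TailState) : 0 < s.maxEnd := s.minEnd_pos.trans s.minEnd_lt_maxEnd

lemma ratioMin_nonneg (s : TailState) : 0 ≤ s.ratioMin := by cases s <;> norm_num [ratioMin]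

lemma ratioMax_le_one (s : TailState) : s.ratioMax ≤ 1 := by cases s <;> norm_num [ratioMax]

/-- With `maxEnd_le_cylHigh`: the rational endpoints are rounded inwards, consistently enough that
the children reach at least as far as their parent on both sides. -/
lemma cylLow_maxTerm_le (s : TailState) : s.cylLow s.maxTerm ≤ s.minEnd := by
  cases s <;> norm_num [cylLow, maxTerm, next, minEnd, maxEnd]

lemma maxEnd_le_cylHigh (s : TailState) : s.maxEnd ≤ s.cylHigh 1 := by
  cases s <;> norm_num [cylHigh, next, minEnd, maxEnd]

lemma topEnd_le (s : TailState) (j : ℕ) : s.topEnd j ≤ s.cylHigh (j + 1) := by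
  unfold topEnd
  split_ifs with h
  · subst h; exact s.maxEnd_le_cylHigh
  · exact le_rfl

lemma cyl_order {s : TailState} {j : ℕ} (h : j + 2 ≤ s.maxTerm) :
    s.minEnd < s.cylHigh (j + 2) ∧ s.cylHigh (j + 2) < s.cylLow (j + 1) ∧
      s.cylLow (j + 1) < s.topEnd j := by
  cases s <;> simp only [maxTerm] at h <;>
    (obtain rfl | rfl | rfl : j = 0 ∨ j = 1 ∨ j = 2 := by omega) <;>
    first
    | omega
    | norm_num [cylLow, cylHigh, topEnd, next, minEnd, maxEnd]

lemma ratioMin_lt_ratioMax (s : TailState) : s.ratioMin < s.ratioMax := by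
  cases s <;> norm_num [ratioMin, ratioMax]

lemma cylLow_pos (s : TailState) (d : ℕ) : 0 < s.cylLow d := by
  have := (s.next d).maxEnd_pos
  unfold cylLow
  positivity

lemma cylHigh_pos (s : TailState) (d : ℕ) : 0 < s.cylHigh d := by
  have := (s.next d).minEnd_pos
  unfold cylHigh
  positivity

/-- A comparison of lengths for all parameters in an interval, from the Bernstein coefficients of
the difference. -/
lemma moebiusLength_le_of_bernstein {x y x' y' a b t : ℝ} (hx : 0 ≤ x) (hy : 0 ≤ y)
    (hx' : 0 ≤ x') (hy' : 0 ≤ y') (ha : 0 ≤ a) (hab : a < b) (ht : t ∈ Set.Icc a b)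
    (h0 : (y - x) * ((1 + a * x') * (1 + a * y')) ≤ (y' - x') * ((1 + a * x) * (1 + a * y)))
    (h1 : (y - x) * ((1 + a * x') * (1 + b * y') + (1 + b * x') * (1 + a * y')) ≤
      (y' - x') * ((1 + a * x) * (1 + b * y) + (1 + b * x) * (1 + a * y)))
    (h2 : (y - x) * ((1 + b * x') * (1 + b * y')) ≤ (y' - x') * ((1 + b * x) * (1 + b * y))) :
    moebiusLength t x y ≤ moebiusLength t x' y' := by
  obtain ⟨hat, htb⟩ := ht
  have ht0 := ha.trans hat
  unfold moebiusLength
  rw [div_le_div_iff₀ (by positivity) (by positivity)]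
  have e0 := mul_nonneg (sq_nonneg (b - t)) (sub_nonneg.2 h0)
  have e1 := mul_nonneg (mul_nonneg (sub_nonneg.2 htb) (sub_nonneg.2 hat)) (sub_nonneg.2 h1)
  have e2 := mul_nonneg (sq_nonneg (t - a)) (sub_nonneg.2 h2)
  have hpos : 0 < (b - a) ^ 2 := by
    have := sub_pos.2 hab
    positivity
  refine le_of_mul_le_mul_left ?_ hpos
  linear_combination e0 + e1 + e2

/-! ### Gap inequalities, state by state -/

variable {s : TailState} {j : ℕ} {t : ℝ}

/-- The gap separates the tails starting with j + 1 from those starting with a larger term. It is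
compared here with the part below it, and in `gap_le_right` with the part above. -/
lemma gap_le_left (h : j + 2 ≤ s.maxTerm) (ht : t ∈ Set.Icc s.ratioMin s.ratioMax) :
    moebiusLength t (s.cylHigh (j + 2)) (s.cylLow (j + 1)) ≤
      moebiusLength t s.minEnd (s.cylHigh (j + 2)) := by
  refine moebiusLength_le_of_bernstein (cylHigh_pos _ _).le (cylLow_pos _ _).le (minEnd_pos _).le
    (cylHigh_pos _ _).le s.ratioMin_nonneg s.ratioMin_lt_ratioMax ht ?_ ?_ ?_ <;>
  cases s <;> simp only [maxTerm] at h <;>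
    (obtain rfl | rfl | rfl : j = 0 ∨ j = 1 ∨ j = 2 := by omega) <;>
    first
    | omega
    | norm_num [cylLow, cylHigh, next, minEnd, maxEnd, ratioMin, ratioMax]

lemma gap_le_right (h : j + 2 ≤ s.maxTerm) (ht : t ∈ Set.Icc s.ratioMin s.ratioMax) :
    moebiusLength t (s.cylHigh (j + 2)) (s.cylLow (j + 1)) ≤
      moebiusLength t (s.cylLow (j + 1)) (s.cylHigh (j + 1)) := by
  refine moebiusLength_le_of_bernstein (cylHigh_pos _ _).le (cylLow_pos _ _).le (cylLow_pos _ _).le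
    (cylHigh_pos _ _).le s.ratioMin_nonneg s.ratioMin_lt_ratioMax ht ?_ ?_ ?_ <;>
  cases s <;> simp only [maxTerm] at h <;>
    (obtain rfl | rfl | rfl : j = 0 ∨ j = 1 ∨ j = 2 := by omega) <;>
    first
    | omega
    | norm_num [cylLow, cylHigh, next, minEnd, maxEnd, ratioMin, ratioMax]

lemma gap_succ_le (h : j + 3 ≤ s.maxTerm) (ht : t ∈ Set.Icc s.ratioMin s.ratioMax) :
    moebiusLength t (s.cylHigh (j + 3)) (s.cylLow (j + 2)) ≤
      moebiusLength t (s.cylHigh (j + 2)) (s.cylLow (j + 1)) := by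
  refine moebiusLength_le_of_bernstein (cylHigh_pos _ _).le (cylLow_pos _ _).le (cylHigh_pos _ _).le
    (cylLow_pos _ _).le s.ratioMin_nonneg s.ratioMin_lt_ratioMax ht ?_ ?_ ?_ <;>
  cases s <;> simp only [maxTerm] at h <;>
    (obtain rfl | rfl : j = 0 ∨ j = 1 := by omega) <;>
    first
    | omega
    | norm_num [cylLow, cylHigh, next, minEnd, maxEnd, ratioMin, ratioMax]

/-- The first gap inside the cylinder of `d` is at most the gap next to it. -/
lemma gap_next_le {d : ℕ} (h : j + 2 ≤ s.maxTerm) (hd : d = j + 1 ∨ d = j + 2)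
    (ht : t ∈ Set.Icc s.ratioMin s.ratioMax) :
    moebiusLength t (1 / (d + (s.next d).cylLow 1)) (1 / (d + (s.next d).cylHigh 2)) ≤
      moebiusLength t (s.cylHigh (j + 2)) (s.cylLow (j + 1)) := by
  have p1 := cylLow_pos (s.next d) 1
  have p2 := cylHigh_pos (s.next d) 2
  refine moebiusLength_le_of_bernstein (by positivity) (by positivity) (cylHigh_pos _ _).le
    (cylLow_pos _ _).le s.ratioMin_nonneg s.ratioMin_lt_ratioMax ht ?_ ?_ ?_ <;>
  clear p1 p2 <;> cases s <;> simp only [maxTerm] at h <;>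
    (obtain rfl | rfl | rfl : j = 0 ∨ j = 1 ∨ j = 2 := by omega) <;>
    first
    | omega
    | (obtain rfl | rfl := hd <;>
        norm_num [cylLow, cylHigh, next, minEnd, maxEnd, ratioMin, ratioMax])

end TailState

/-! ### The tree of cylinders -/

/-- The state reached after a word; words are stored with the last term first, and the word is
preceded by a term treated as `4`. -/
def wordState : List ℕ → TailState
  | [] => TailState.four
  | d :: w => (wordState w).next d

/-- All terms of a word are allowed. -/
def ValidWord : List ℕ → Prop
  | [] => True
  | d :: w => ValidWord w ∧ 1 ≤ d ∧ d ≤ (wordState w).maxTerm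

/-- The continuant ratio after a word, starting from `t`. -/
noncomputable def wordRatio (t : ℝ) : List ℕ → ℝ
  | [] => t
  | d :: w => 1 / (d + wordRatio t w)

/-- The logarithm of `[p; w, z]`. -/
noncomputable def logCyl (p : ℕ) : List ℕ → ℝ → ℝ
  | [], z => Real.log (p + z)
  | d :: w, z => logCyl p w (1 / (d + z))

section Words

variable {p : ℕ} {w : List ℕ}

lemma wordRatio_mem {t : ℝ} (ht : t ∈ Set.Icc (0 : ℝ) (1 / 4)) (hw : ValidWord w) :
    wordRatio t w ∈ Set.Icc (wordState w).ratioMin (wordState w).ratioMax := by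
  induction w with
  | nil => simpa [wordRatio, wordState, TailState.ratioMin, TailState.ratioMax] using ht
  | cons d w ih => exact TailState.ratio_next hw.2.1 hw.2.2 (ih hw.1)

lemma wordRatio_nonneg {t : ℝ} (ht : 0 ≤ t) (w : List ℕ) : 0 ≤ wordRatio t w := by
  induction w with
  | nil => exact ht
  | cons d w ih => exact div_nonneg zero_le_one (add_nonneg (Nat.cast_nonneg d) ih)

/-- As a function of z, [p; w, z] is a quotient of two linear functions. Normalizing both to
constant term 1 leaves the continuant ratios with seeds 1/p (numerator) and 0 (denominator) as
slopes. -/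
lemma logCyl_eq (hp : 1 ≤ p) (hw : ValidWord w) : ∃ c, ∀ z, 0 ≤ z → logCyl p w z =
    c + Real.log (1 + wordRatio (1 / p) w * z) - Real.log (1 + wordRatio 0 w * z) := by
  have hp' : (1 : ℝ) ≤ p := by exact_mod_cast hp
  induction w with
  | nil =>
    refine ⟨Real.log p, fun z hz => ?_⟩
    simp only [logCyl, wordRatio, zero_mul, add_zero, Real.log_one, sub_zero]
    rw [← Real.log_mul (by positivity) (by positivity)]
    congr 1
    field_simp
  | cons d w ih =>
    obtain ⟨c, hc⟩ := ih hw.1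
    have hd : (1 : ℝ) ≤ d := by exact_mod_cast hw.2.1
    have h1 := wordRatio_nonneg (t := 1 / p) (by positivity) w
    have h2 := wordRatio_nonneg (t := 0) le_rfl w
    refine ⟨c + Real.log ((d + wordRatio (1 / p) w) / (d + wordRatio 0 w)), fun z hz => ?_⟩
    simp only [logCyl, wordRatio]
    rw [hc _ (by positivity)]
    generalize wordRatio (1 / p) w = a at *
    generalize wordRatio 0 w = b at *
    have e : ∀ a : ℝ, 0 ≤ a → Real.log (1 + a * (1 / (d + z))) =
        Real.log (d + a) + Real.log (1 + 1 / (d + a) * z) - Real.log (d + z) := by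
      intro a ha
      rw [← Real.log_mul (by positivity) (by positivity), ← Real.log_div (by positivity)
        (by positivity)]
      congr 1
      field_simp
      ring
    rw [e a h1, e b h2, Real.log_div (by positivity) (by positivity)]
    ring

lemma logCyl_sub (hp : 1 ≤ p) (hw : ValidWord w) {x y : ℝ} (hx : 0 ≤ x) (hy : 0 ≤ y) :
    logCyl p w y - logCyl p w x =
      logRatio x y (wordRatio (1 / p) w) - logRatio x y (wordRatio 0 w) := by
  obtain ⟨c, hc⟩ := logCyl_eq hp hw
  rw [hc y hy, hc x hx, logRatio, logRatio]
  ring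

/-- A logarithmic length is the integral of `moebiusLength` between the two continuant ratios. For p
≥ 4 both seeds lie in [0, 1/4], so both ratios lie in the range attached to the state, independently
of p. -/
lemma abs_logCyl_sub_le (hp : 4 ≤ p) (hw : ValidWord w) {x y x' y' : ℝ} (hx : 0 ≤ x) (hxy : x ≤ y)
    (hx' : 0 ≤ x') (hxy' : x' ≤ y')
    (h : ∀ t ∈ Set.Icc (wordState w).ratioMin (wordState w).ratioMax,
      moebiusLength t x y ≤ moebiusLength t x' y') :
    |logCyl p w y - logCyl p w x| ≤ |logCyl p w y' - logCyl p w x'| := by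
  have hp' : (4 : ℝ) ≤ p := by exact_mod_cast hp
  rw [logCyl_sub (by omega) hw hx (hx.trans hxy), logCyl_sub (by omega) hw hx' (hx'.trans hxy')]
  exact abs_logRatio_sub_le_abs hx hxy hx' hxy' (TailState.ratioMin_nonneg _)
    (wordRatio_mem ⟨le_rfl, by norm_num⟩ hw)
    (wordRatio_mem ⟨by positivity, one_div_le_one_div_of_le (by norm_num) hp'⟩ hw) h

lemma monotoneOn_or_antitoneOn_logCyl (hp : 1 ≤ p) (hw : ValidWord w) :
    MonotoneOn (logCyl p w) (Set.Ici 0) ∨ AntitoneOn (logCyl p w) (Set.Ici 0) := by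
  have h1 := wordRatio_nonneg (t := 1 / (p : ℝ)) (by positivity) w
  have h2 := wordRatio_nonneg (t := 0) le_rfl w
  rcases le_total (wordRatio 0 w) (wordRatio (1 / p) w) with h | h
  · left
    intro x hx y hy hxy
    have := logCyl_sub hp hw hx hy
    linarith [logRatio_mono hx hxy h2 h]
  · right
    intro x hx y hy hxy
    have := logCyl_sub hp hw hx hy
    linarith [logRatio_mono hx hxy h1 h]

lemma wordRatio_ne (hp : 1 ≤ p) (w : List ℕ) : wordRatio 0 w ≠ wordRatio (1 / p) w := by
  have hp' : (1 : ℝ) ≤ p := by exact_mod_cast hp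
  induction w with
  | nil =>
    have : 0 < 1 / (p : ℝ) := by positivity
    exact this.ne
  | cons d w ih =>
    intro h
    simp only [wordRatio, one_div] at h ih
    exact ih (by simpa using inv_injective h)

/-- After the first term both ratios are at least 1/5, so a further step divides their difference by
at least (6/5)² ≥ 4/3. -/
lemma abs_wordRatio_sub_le (hp : 4 ≤ p) (hw : ValidWord w) :
    |wordRatio (1 / p) w - wordRatio 0 w| ≤ 2 * (3 / 4) ^ w.length := by
  have hp' : (4 : ℝ) ≤ p := by exact_mod_cast hp
  have hp4 : 1 / (p : ℝ) ≤ 1 / 4 := one_div_le_one_div_of_le (by norm_num) hp'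
  have hp0 : 0 ≤ 1 / (p : ℝ) := by positivity
  induction w with
  | nil =>
    simp only [wordRatio, List.length_nil, pow_zero, sub_zero]
    rw [abs_of_nonneg hp0]
    linarith
  | cons d w ih =>
    cases w with
    | nil =>
      have h1 := wordRatio_mem (t := 1 / p) ⟨hp0, hp4⟩ hw
      have h2 := wordRatio_mem (t := 0) ⟨le_rfl, by norm_num⟩ hw
      have h3 := (wordState [d]).ratioMin_nonneg
      have h4 := (wordState [d]).ratioMax_le_one
      rw [abs_le]
      simp only [List.length_cons, List.length_nil, zero_add, pow_one]
      constructor <;> linarith [h1.1, h1.2, h2.1, h2.2]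
    | cons e w =>
      have ih := ih hw.1
      have hd : (1 : ℝ) ≤ d := by exact_mod_cast hw.2.1
      have he : (1 : ℝ) ≤ e := by exact_mod_cast hw.1.2.1
      have he4 : (e : ℝ) ≤ 4 := by
        have : e ≤ 4 := hw.1.2.2.trans (by cases wordState w <;> simp [TailState.maxTerm])
        exact_mod_cast this
      have hlow : ∀ t : ℝ, t ∈ Set.Icc (0 : ℝ) (1 / 4) → 1 / 5 ≤ wordRatio t (e :: w) := by
        intro t ht
        have h1 := wordRatio_mem ht hw.1.1
        have h2 := wordRatio_nonneg ht.1 w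
        have h3 := (wordState w).ratioMax_le_one
        simp only [wordRatio]
        exact one_div_le_one_div_of_le (by linarith) (by linarith [h1.2])
      have h1 := hlow (1 / p) ⟨hp0, hp4⟩
      have h2 := hlow 0 ⟨le_rfl, by norm_num⟩
      rw [wordRatio, wordRatio.eq_2 0, List.length_cons, pow_succ]
      generalize wordRatio (1 / p) (e :: w) = a at *
      generalize wordRatio 0 (e :: w) = b at *
      have e1 : 1 / ((d : ℝ) + a) - 1 / (d + b) = (b - a) / ((d + a) * (d + b)) := by
        field_simp
        ring
      have e2 : (4 / 3 : ℝ) ≤ (d + a) * (d + b) := by nlinarith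
      rw [e1, abs_div, abs_sub_comm, abs_of_pos (by positivity : 0 < (d + a) * (d + b)),
        div_le_iff₀ (by positivity)]
      have hpow : (0 : ℝ) ≤ (3 / 4) ^ (e :: w).length := by positivity
      nlinarith

lemma abs_logCyl_sub_le_pow (hp : 4 ≤ p) (hw : ValidWord w) {x y : ℝ} (hx : x ∈ Set.Icc (0 : ℝ) 1)
    (hy : y ∈ Set.Icc (0 : ℝ) 1) :
    |logCyl p w y - logCyl p w x| ≤ 2 * (3 / 4) ^ w.length := by
  have key : ∀ x y : ℝ, 0 ≤ x → x ≤ y → y ≤ 1 →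
      |logCyl p w y - logCyl p w x| ≤ 2 * (3 / 4) ^ w.length := by
    intro x y hx hxy hy
    rw [logCyl_sub (by omega) hw hx (hx.trans hxy)]
    exact (abs_logRatio_sub_le hx hxy hy (wordRatio_nonneg le_rfl w)
      (wordRatio_nonneg (by positivity) w)).trans (abs_wordRatio_sub_le hp hw)
  rcases le_total x y with h | h
  · exact key x y hx.1 h hy.2
  · rw [abs_sub_comm]
    exact key y x hy.1 h hx.2

end Words

/-- A cylinder of tails: the word `word` followed by a term larger than `level`. -/
structure CylNode where
  word : List ℕ
  level : ℕ
  valid : ValidWord word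
  level_le : level + 2 ≤ (wordState word).maxTerm

lemma TailState.three_le_maxTerm (s : TailState) : 3 ≤ s.maxTerm := by
  cases s <;> simp [TailState.maxTerm]

namespace CylNode

/-- The state at a node. -/
def state (n : CylNode) : TailState := wordState n.word

/-- The cylinder of all extensions of the word by `d`. -/
def extend (n : CylNode) (d : ℕ) (h1 : 1 ≤ d) (hd : d ≤ n.state.maxTerm) : CylNode where
  word := d :: n.word
  level := 0
  valid := ⟨n.valid, h1, hd⟩
  level_le := (by have := (wordState (d :: n.word)).three_le_maxTerm; omega)

/-- The two children: the next term is `level + 1`, or it is larger. -/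
def child (n : CylNode) : Bool → CylNode
  | true => n.extend (n.level + 1) (by omega) (by have := n.level_le; rw [state]; omega)
  | false =>
    if h : n.level + 3 ≤ (wordState n.word).maxTerm then ⟨n.word, n.level + 1, n.valid, h⟩
    else n.extend (n.level + 2) (by omega) n.level_le

variable (p : ℕ)

/-- The value at the lower end of the interval of tails. -/
noncomputable def botVal (n : CylNode) : ℝ := logCyl p n.word n.state.minEnd

/-- The value at the upper end of the interval of tails. -/
noncomputable def topVal (n : CylNode) : ℝ := logCyl p n.word (n.state.topEnd n.level)

/-- The value at the lower end of the gap. -/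
noncomputable def gapBotVal (n : CylNode) : ℝ := logCyl p n.word (n.state.cylHigh (n.level + 2))

/-- The value at the upper end of the gap. -/
noncomputable def gapTopVal (n : CylNode) : ℝ := logCyl p n.word (n.state.cylLow (n.level + 1))

variable {p} (n : CylNode)

lemma topVal_child_true : (n.child true).topVal p =
    logCyl p n.word (n.state.cylLow (n.level + 1)) := by
  simp [topVal, child, extend, state, TailState.topEnd, logCyl, wordState, TailState.cylLow]

lemma botVal_child_true : (n.child true).botVal p =
    logCyl p n.word (n.state.cylHigh (n.level + 1)) := by
  simp [botVal, child, extend, state, logCyl, wordState, TailState.cylHigh]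

lemma child_false_of_le (h : n.level + 3 ≤ (wordState n.word).maxTerm) :
    n.child false = ⟨n.word, n.level + 1, n.valid, h⟩ := by
  simp [child, h]

lemma child_false_of_not_le (h : ¬n.level + 3 ≤ (wordState n.word).maxTerm) :
    n.child false = n.extend (n.level + 2) (by omega) n.level_le := by
  simp [child, h]

/-- The values at the ends of the lower child: the gap starts at one end, and the other end lies
at or below the lower end of the parent. -/
lemma child_false_vals : ∃ z, 0 < z ∧ z ≤ n.state.minEnd ∧
    (((n.child false).botVal p = logCyl p n.word z ∧
      (n.child false).topVal p = n.gapBotVal p) ∨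
    ((n.child false).topVal p = logCyl p n.word z ∧
      (n.child false).botVal p = n.gapBotVal p)) := by
  by_cases h : n.level + 3 ≤ (wordState n.word).maxTerm
  · refine ⟨n.state.minEnd, n.state.minEnd_pos, le_rfl, Or.inl ?_⟩
    rw [n.child_false_of_le h]
    exact ⟨rfl, rfl⟩
  · refine ⟨n.state.cylLow (n.level + 2), TailState.cylLow_pos _ _, ?_, Or.inr ?_⟩
    · have := n.level_le
      have h2 : n.level + 2 = (wordState n.word).maxTerm := by omega
      rw [h2]
      exact TailState.cylLow_maxTerm_le _
    · rw [n.child_false_of_not_le h]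
      simp [topVal, botVal, gapBotVal, extend, state, TailState.topEnd, logCyl, wordState,
        TailState.cylLow, TailState.cylHigh]

lemma topEnd_le_one : n.state.cylHigh (n.level + 1) ≤ 1 := by
  have := (n.state.next (n.level + 1)).minEnd_pos
  rw [TailState.cylHigh, div_le_one (by positivity)]
  push_cast
  linarith [Nat.cast_nonneg (α := ℝ) n.level]

lemma order : 0 < n.state.minEnd ∧ n.state.minEnd < n.state.cylHigh (n.level + 2) ∧
    n.state.cylHigh (n.level + 2) < n.state.cylLow (n.level + 1) ∧
      n.state.cylLow (n.level + 1) < n.state.topEnd n.level ∧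
      n.state.topEnd n.level ≤ n.state.cylHigh (n.level + 1) ∧
      n.state.cylHigh (n.level + 1) ≤ 1 := by
  obtain ⟨h1, h2, h3⟩ := TailState.cyl_order n.level_le
  exact ⟨n.state.minEnd_pos, h1, h2, h3, n.state.topEnd_le _, n.topEnd_le_one⟩

lemma gapVal_ne (hp : 4 ≤ p) : n.gapBotVal p ≠ n.gapTopVal p := by
  obtain ⟨h0, h1, h2, -⟩ := n.order
  intro h
  have h3 := logCyl_sub (p := p) (by omega) n.valid (h0.trans h1).le ((h0.trans h1).trans h2).le
  rw [gapBotVal, gapTopVal] at h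
  exact logRatio_ne (h0.trans h1).le h2 (wordRatio_nonneg le_rfl n.word)
    (wordRatio_nonneg (by positivity) n.word) (wordRatio_ne (p := p) (by omega) n.word)
    (by linarith)

lemma gap_le_child_false (hp : 4 ≤ p) : |n.gapTopVal p - n.gapBotVal p| ≤
    |(n.child false).topVal p - (n.child false).botVal p| := by
  obtain ⟨h0, h1, h2, -⟩ := n.order
  obtain ⟨z, hz0, hz, h⟩ := n.child_false_vals (p := p)
  have key : |n.gapTopVal p - n.gapBotVal p| ≤ |n.gapBotVal p - logCyl p n.word z| := by
    refine abs_logCyl_sub_le hp n.valid (h0.trans h1).le h2.le hz0.le (hz.trans h1.le)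
      fun t ht => (TailState.gap_le_left n.level_le ht).trans ?_
    have ht0 := (TailState.ratioMin_nonneg _).trans ht.1
    have hc := h0.trans h1
    unfold moebiusLength
    rw [div_le_div_iff₀ (by positivity) (by positivity)]
    change (n.state.cylHigh (n.level + 2) - n.state.minEnd) * _ ≤
      (n.state.cylHigh (n.level + 2) - z) * ((1 + t * n.state.minEnd) * _)
    -- Lowering the bottom end from `minEnd` to z only lengthens the Möbius image.
    have hcross : (n.state.cylHigh (n.level + 2) - n.state.minEnd) * (1 + t * z) ≤
        (n.state.cylHigh (n.level + 2) - z) * (1 + t * n.state.minEnd) := by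
      nlinarith [mul_nonneg (mul_nonneg ht0 hc.le) (sub_nonneg.2 hz)]
    have := mul_le_mul_of_nonneg_right hcross
      (by positivity : 0 ≤ 1 + t * n.state.cylHigh (n.level + 2))
    unfold state at *
    nlinarith
  rcases h with ⟨h3, h4⟩ | ⟨h3, h4⟩
  · rwa [h3, h4]
  · rw [h3, h4, abs_sub_comm (logCyl p n.word z)]
    exact key

lemma gap_le_child_true (hp : 4 ≤ p) : |n.gapTopVal p - n.gapBotVal p| ≤
    |(n.child true).topVal p - (n.child true).botVal p| := by
  obtain ⟨h0, h1, h2, h3, h4, -⟩ := n.order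
  rw [topVal_child_true, botVal_child_true, abs_sub_comm (logCyl p n.word (n.state.cylLow _))]
  exact abs_logCyl_sub_le hp n.valid (h0.trans h1).le h2.le ((h0.trans h1).trans h2).le
    (h3.le.trans h4) fun t ht => TailState.gap_le_right n.level_le ht

lemma gap_extend_le (hp : 4 ≤ p) {d : ℕ} (h1 : 1 ≤ d) (hd : d ≤ n.state.maxTerm)
    (hdl : d = n.level + 1 ∨ d = n.level + 2) :
    |(n.extend d h1 hd).gapTopVal p - (n.extend d h1 hd).gapBotVal p| ≤
      |n.gapTopVal p - n.gapBotVal p| := by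
  obtain ⟨h0, h01, h2, -⟩ := n.order
  obtain ⟨k0, k1, k2, -⟩ := (n.extend d h1 hd).order
  have hd0 : (1 : ℝ) ≤ d := by exact_mod_cast h1
  rw [abs_sub_comm]
  refine abs_logCyl_sub_le (x := 1 / (d + (n.state.next d).cylLow 1))
    (y := 1 / (d + (n.state.next d).cylHigh 2)) hp n.valid ?_ ?_ (h0.trans h01).le h2.le
    fun t ht => TailState.gap_next_le n.level_le hdl ht
  · have := TailState.cylLow_pos (n.state.next d) 1
    positivity
  · have := TailState.cylHigh_pos (n.state.next d) 2
    exact one_div_le_one_div_of_le (by positivity) (by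
      have : (n.state.next d).cylHigh 2 < (n.state.next d).cylLow 1 := k2
      linarith)

lemma gap_child_le (hp : 4 ≤ p) (b : Bool) :
    |(n.child b).gapTopVal p - (n.child b).gapBotVal p| ≤ |n.gapTopVal p - n.gapBotVal p| := by
  cases b with
  | true => exact n.gap_extend_le hp (by omega) (by have := n.level_le; rw [state]; omega) (Or.inl rfl)
  | false =>
    by_cases h : n.level + 3 ≤ (wordState n.word).maxTerm
    · rw [n.child_false_of_le h]
      obtain ⟨h0, h01, h2, -⟩ := n.order
      obtain ⟨k0, k1, k2, -⟩ := CylNode.order ⟨n.word, n.level + 1, n.valid, h⟩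
      exact abs_logCyl_sub_le hp n.valid (k0.trans k1).le k2.le (h0.trans h01).le h2.le
        fun t ht => TailState.gap_succ_le h ht
    · rw [n.child_false_of_not_le h]
      exact n.gap_extend_le hp (by omega) n.level_le (Or.inr rfl)

/-- Nodes ordered by the number of choices made. -/
def depth (n : CylNode) : ℕ := 3 * n.word.length + n.level

lemma level_le_two : n.level ≤ 2 := by
  have := n.level_le
  have : (wordState n.word).maxTerm ≤ 4 := by cases wordState n.word <;> simp [TailState.maxTerm]
  omega

lemma depth_lt (b : Bool) : n.depth < (n.child b).depth := by
  have := n.level_le_two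
  cases b with
  | true => simp only [depth, child, extend, List.length_cons]; omega
  | false =>
    by_cases h : n.level + 3 ≤ (wordState n.word).maxTerm
    · rw [n.child_false_of_le h]
      simp only [depth]
      omega
    · rw [n.child_false_of_not_le h]
      simp only [depth, extend, List.length_cons]
      omega

lemma exists_depth_pow_lt {ε : ℝ} (hε : 0 < ε) :
    ∃ D, ∀ n : CylNode, D ≤ n.depth → 2 * (3 / 4 : ℝ) ^ n.word.length < ε := by
  obtain ⟨k, hk⟩ := exists_pow_lt_of_lt_one (half_pos hε) (by norm_num : (3 / 4 : ℝ) < 1)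
  refine ⟨3 * k + 2, fun n hn => ?_⟩
  have h1 := n.level_le_two
  have h2 : k ≤ n.word.length := by
    unfold depth at hn
    omega
  have := pow_le_pow_of_le_one (by norm_num : (0 : ℝ) ≤ 3 / 4) (by norm_num) h2
  linarith

lemma abs_gap_le_pow (hp : 4 ≤ p) :
    |n.gapTopVal p - n.gapBotVal p| ≤ 2 * (3 / 4 : ℝ) ^ n.word.length := by
  obtain ⟨h0, h1, h2, h3, h4, h5⟩ := n.order
  exact abs_logCyl_sub_le_pow hp n.valid ⟨by linarith, by linarith⟩ ⟨by linarith, by linarith⟩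

/-- The tree of cylinders with central term `p`. -/
noncomputable def tree (p : ℕ) (hp : 4 ≤ p) : GapTree CylNode where
  lo n := min (n.botVal p) (n.topVal p)
  hi n := max (n.botVal p) (n.topVal p)
  gap n := |n.gapTopVal p - n.gapBotVal p|
  child := child
  depth := depth
  gap_pos n := abs_pos.2 (sub_ne_zero.2 (n.gapVal_ne hp).symm)
  gap_le n b := by
    rw [max_sub_min_eq_abs]
    cases b
    · exact n.gap_le_child_false hp
    · exact n.gap_le_child_true hp
  gap_child_le n b := n.gap_child_le hp b
  depth_lt := depth_lt
  shrink ε hε := by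
    obtain ⟨D, hD⟩ := exists_depth_pow_lt hε
    exact ⟨D, fun n hn => (n.abs_gap_le_pow hp).trans_lt (hD n hn)⟩
  cover n x hx := by
    obtain ⟨h0, h1, h2, h3, h4, h5⟩ := n.order
    obtain ⟨z, hz0, hz, hfalse⟩ := n.child_false_vals (p := p)
    have m0 : z ∈ Set.Ici (0 : ℝ) := hz0.le
    have m1 : n.state.minEnd ∈ Set.Ici (0 : ℝ) := h0.le
    have m2 : n.state.cylHigh (n.level + 2) ∈ Set.Ici (0 : ℝ) := m1.trans h1.le
    have m3 : n.state.cylLow (n.level + 1) ∈ Set.Ici (0 : ℝ) := m2.trans h2.le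
    have m4 : n.state.topEnd n.level ∈ Set.Ici (0 : ℝ) := m3.trans h3.le
    have m5 : n.state.cylHigh (n.level + 1) ∈ Set.Ici (0 : ℝ) := m4.trans h4
    have hF : Set.Icc (min ((n.child false).botVal p) ((n.child false).topVal p))
        (max ((n.child false).botVal p) ((n.child false).topVal p)) =
        Set.uIcc (logCyl p n.word z) (n.gapBotVal p) := by
      rcases hfalse with ⟨e1, e2⟩ | ⟨e1, e2⟩
      · rw [e1, e2, Set.uIcc]
      · rw [e1, e2, min_comm, max_comm, Set.uIcc]
    have hT : Set.Icc (min ((n.child true).botVal p) ((n.child true).topVal p))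
        (max ((n.child true).botVal p) ((n.child true).topVal p)) =
        Set.uIcc (n.gapTopVal p) (logCyl p n.word (n.state.cylHigh (n.level + 1))) := by
      rw [topVal_child_true, botVal_child_true, min_comm, max_comm, Set.uIcc, gapTopVal]
    have hx' : x ∈ Set.uIcc (n.botVal p) (n.topVal p) := hx
    -- The orientation of a cylinder depends on its word; in either case x lies in a child or in the
    -- gap.
    rcases monotoneOn_or_antitoneOn_logCyl (p := p) (by omega) n.valid with hm | hm
    · have a0 : logCyl p n.word z ≤ n.botVal p := hm m0 m1 hz
      have a1 : n.botVal p ≤ n.gapBotVal p := hm m1 m2 h1.le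
      have a2 : n.gapBotVal p ≤ n.gapTopVal p := hm m2 m3 h2.le
      have a3 : n.gapTopVal p ≤ n.topVal p := hm m3 m4 h3.le
      have a4 : n.topVal p ≤ logCyl p n.word (n.state.cylHigh (n.level + 1)) := hm m4 m5 h4
      rw [Set.uIcc_of_le (by linarith)] at hx' hF hT
      rcases le_or_gt x (n.gapBotVal p) with hc | hc
      · exact Or.inl ⟨false, hF ▸ ⟨a0.trans hx'.1, hc⟩⟩
      rcases le_or_gt (n.gapTopVal p) x with hc' | hc'
      · exact Or.inl ⟨true, hT ▸ ⟨hc', hx'.2.trans a4⟩⟩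
      · exact Or.inr ⟨false, true, n.gapBotVal p, n.gapTopVal p, hF ▸ ⟨a0.trans a1, le_rfl⟩,
          hT ▸ ⟨le_rfl, a3.trans a4⟩, hc.le, hc'.le, le_abs_self _⟩
    · have a0 : n.botVal p ≤ logCyl p n.word z := hm m0 m1 hz
      have a1 : n.gapBotVal p ≤ n.botVal p := hm m1 m2 h1.le
      have a2 : n.gapTopVal p ≤ n.gapBotVal p := hm m2 m3 h2.le
      have a3 : n.topVal p ≤ n.gapTopVal p := hm m3 m4 h3.le
      have a4 : logCyl p n.word (n.state.cylHigh (n.level + 1)) ≤ n.topVal p := hm m4 m5 h4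
      rw [Set.uIcc_of_ge (by linarith)] at hx' hF hT
      rcases le_or_gt x (n.gapTopVal p) with hc | hc
      · exact Or.inl ⟨true, hT ▸ ⟨a4.trans hx'.1, hc⟩⟩
      rcases le_or_gt (n.gapBotVal p) x with hc' | hc'
      · exact Or.inl ⟨false, hF ▸ ⟨hc', hx'.2.trans a0⟩⟩
      · exact Or.inr ⟨true, false, n.gapTopVal p, n.gapBotVal p, hT ▸ ⟨a4.trans a3, le_rfl⟩,
          hF ▸ ⟨le_rfl, a1.trans a0⟩, hc.le, hc'.le, by rw [abs_sub_comm]; exact le_abs_self _⟩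

end CylNode

/-! ### Tails of prescribed product -/

/-- The first `n` terms of a sequence, last term first. -/
def wordOf (u : ℕ → ℕ) : ℕ → List ℕ
  | 0 => []
  | n + 1 => u n :: wordOf u n

/-- The `i`-th term of a word stored with the last term first. -/
def wordTerm (w : List ℕ) (i : ℕ) : ℕ := w.reverse.getD i 0

section WordOf

variable {u v : ℕ → ℕ}

lemma wordOf_congr {n : ℕ} (h : ∀ i < n, u i = v i) : wordOf u n = wordOf v n := by
  induction n with
  | zero => rfl
  | succ n ih =>
    rw [wordOf, wordOf, h n (by omega), ih fun i hi => h i (by omega)]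

lemma wordTerm_append {w w' : List ℕ} {i : ℕ} (hi : i < w.length) :
    wordTerm (w' ++ w) i = wordTerm w i := by
  unfold wordTerm
  rw [List.reverse_append, List.getD_append _ _ _ _ (by simpa using hi)]

lemma wordOf_wordTerm (w : List ℕ) : wordOf (wordTerm w) w.length = w := by
  induction w with
  | nil => rfl
  | cons d w ih =>
    rw [List.length_cons, wordOf]
    congr 1
    · simp [wordTerm]
    · exact (wordOf_congr fun i hi => wordTerm_append (w' := [d]) hi).trans ih

/-- Words are stored last term first, so extending a word makes the old one a suffix; nested words
of unbounded length determine a sequence. -/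
lemma exists_eq_wordOf {W : ℕ → List ℕ} (hs : ∀ k, W k <:+ W (k + 1))
    (hl : ∀ n, ∃ k, n < (W k).length) : ∃ u, ∀ k, W k = wordOf u (W k).length := by
  choose K hK using hl
  have hmono : ∀ k l, k ≤ l → W k <:+ W l := fun k l hkl =>
    Nat.le_induction (List.suffix_refl _) (fun l _ ih => ih.trans (hs l)) l hkl
  refine ⟨fun i => wordTerm (W (K i)) i, fun k => ?_⟩
  nth_rw 1 [← wordOf_wordTerm (W k)]
  refine wordOf_congr fun i hi => ?_
  rcases le_total k (K i) with h | h
  · obtain ⟨t, ht⟩ := hmono _ _ h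
    rw [← ht, wordTerm_append hi]
  · obtain ⟨t, ht⟩ := hmono _ _ h
    rw [← ht, wordTerm_append (hK i)]

lemma ValidWord.wordOf_of_le {m n : ℕ} (h : ValidWord (wordOf u n)) (hmn : m ≤ n) :
    ValidWord (wordOf u m) := by
  induction n with
  | zero => rwa [Nat.le_zero.1 hmn]
  | succ n ih =>
    rcases Nat.lt_or_eq_of_le hmn with h1 | rfl
    · exact ih h.1 (by omega)
    · exact h

lemma logCyl_wordOf {p : ℕ} (hu : ∀ i, 1 ≤ u i) (n : ℕ) :
    logCyl p (wordOf u n) (cfValue (dropTerms n u)) = Real.log (p + cfValue u) := by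
  induction n with
  | zero =>
    have : dropTerms 0 u = u := by funext i; simp [dropTerms]
    rw [wordOf, logCyl, this]
  | succ n ih =>
    rw [← ih, wordOf, logCyl, cfValue_eq (dropTerms_pos hu n), dropTerms_dropTerms]
    rfl

lemma TailState.eq_of_four_le {s : TailState} (h : 4 ≤ s.maxTerm) :
    s = free ∨ s = fourOne := by
  cases s <;> simp_all [maxTerm]

/-- After a 4 the state is `four` or `fourOneFour`, which exclude another 4. Reading 4141 with valid
terms ends in `fourOneFourOne`, which excludes the final 4 of 41414. -/
lemma admissibleTail_of_validWord (h : ∀ n, ValidWord (wordOf u n)) : AdmissibleTail u := by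
  have hstep : ∀ n, 1 ≤ u n ∧ u n ≤ (wordState (wordOf u n)).maxTerm := fun n => (h (n + 1)).2
  have hnext : ∀ n, wordState (wordOf u (n + 1)) = (wordState (wordOf u n)).next (u n) :=
    fun _ => rfl
  have hfour : ∀ i, consTerm 4 u i = 4 → wordState (wordOf u i) = TailState.four ∨
      wordState (wordOf u i) = TailState.fourOneFour := by
    intro i hi
    cases i with
    | zero => exact Or.inl rfl
    | succ i =>
      have hi' : u i = 4 := hi
      have h1 := (hstep i).2
      rw [hi'] at h1
      rw [hnext, hi']
      rcases TailState.eq_of_four_le h1 with h2 | h2 <;> rw [h2] <;> simp [TailState.next]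
  have hthree : ∀ i, consTerm 4 u i = 4 → u i ≤ 3 := by
    intro i hi
    have h1 := (hstep i).2
    rcases hfour i hi with h2 | h2 <;> rw [h2] at h1 <;> exact h1
  refine ⟨fun n => ⟨(hstep n).1, (hstep n).2.trans ?_⟩, fun i hi => ?_, fun i hi => ?_⟩
  · cases wordState (wordOf u n) <;> simp [TailState.maxTerm]
  · have := hthree i hi.1
    have h2 : u i = 4 := hi.2
    omega
  · obtain ⟨h0, h1, h2, h3, h4⟩ := hi
    have h1 : u i = 1 := h1
    have h2 : u (i + 1) = 4 := h2
    have h3 : u (i + 2) = 1 := h3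
    have h4 : u (i + 3) = 4 := h4
    have s1 : wordState (wordOf u (i + 1)) = TailState.fourOne := by
      have hm := (hstep (i + 1)).2
      rw [h2] at hm
      rcases TailState.eq_of_four_le hm with h5 | h5
      · rw [hnext, h1] at h5
        rcases hfour i h0 with h6 | h6 <;> rw [h6] at h5 <;> simp [TailState.next] at h5
      · exact h5
    have s2 : wordState (wordOf u (i + 2)) = TailState.fourOneFour := by
      rw [hnext, s1, h2]; simp [TailState.next]
    have s3 : wordState (wordOf u (i + 3)) = TailState.fourOneFourOne := by
      rw [hnext, s2, h3]; simp [TailState.next]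
    have hm := (hstep (i + 3)).2
    rw [s3, h4] at hm
    simp [TailState.maxTerm] at hm

end WordOf

namespace CylNode

variable {p q : ℕ}

lemma word_suffix_of_transGen {hp : 4 ≤ p} {n n' : CylNode}
    (h : Relation.TransGen (tree p hp).IsChild n n') : n.word <:+ n'.word := by
  have hc : ∀ n : CylNode, ∀ b, n.word <:+ (n.child b).word := by
    intro n b
    cases b with
    | true => exact List.suffix_cons _ _
    | false =>
      by_cases h : n.level + 3 ≤ (wordState n.word).maxTerm
      · rw [n.child_false_of_le h]
      · rw [n.child_false_of_not_le h]
        exact List.suffix_cons _ _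
  induction h with
  | single h => obtain ⟨b, rfl⟩ := h; exact hc _ b
  | tail _ h ih => obtain ⟨b, rfl⟩ := h; exact ih.trans (hc _ b)

/-- A descending sequence of cylinders shrinks to an admissible tail. -/
lemma exists_tail {hp : 4 ≤ p} {f : ℕ → CylNode}
    (hf : ∀ k, Relation.TransGen (tree p hp).IsChild (f k) (f (k + 1))) :
    ∃ u, AdmissibleTail u ∧ ∀ x : ℕ → ℝ,
      (∀ k, x k ∈ Set.Icc ((tree p hp).lo (f k)) ((tree p hp).hi (f k))) →
      Filter.Tendsto x Filter.atTop (nhds (Real.log (p + cfValue u))) := by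
  have hdepth : ∀ k, k ≤ (f k).depth := by
    intro k
    induction k with
    | zero => exact Nat.zero_le _
    | succ k ih =>
      have : (f k).depth < (f (k + 1)).depth := GapTree.depth_lt_of_transGen (hf k)
      omega
  have hlen : ∀ k, k ≤ 3 * (f k).word.length + 2 := by
    intro k
    have h1 := hdepth k
    have h2 := (f k).level_le_two
    unfold depth at h1
    omega
  obtain ⟨u, hu⟩ := exists_eq_wordOf (W := fun k => (f k).word)
    (fun k => word_suffix_of_transGen (hf k)) fun n => ⟨3 * n + 5, by
      have := hlen (3 * n + 5)
      omega⟩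
  have hvalid : ∀ n, ValidWord (wordOf u n) := by
    intro n
    have h1 := (f (3 * n + 2)).valid
    have h2 := hu (3 * n + 2)
    rw [h2] at h1
    exact h1.wordOf_of_le (by have := hlen (3 * n + 2); omega)
  have hadm := admissibleTail_of_validWord hvalid
  refine ⟨u, hadm, fun x hx => ?_⟩
  have hup := hadm.terms.pos
  rw [Metric.tendsto_atTop]
  intro ε hε
  obtain ⟨D, hD⟩ := exists_depth_pow_lt (half_pos hε)
  refine ⟨D, fun k hk => ?_⟩
  have hpow := hD (f k) (hk.trans (hdepth k))
  obtain ⟨h0, h1, h2, h3, h4, h5⟩ := (f k).order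
  have hz := cfValue_mem_Icc (dropTerms_pos hup (f k).word.length)
  have hlog := logCyl_wordOf (p := p) hup (f k).word.length
  have hw := hu k
  rw [← hw] at hlog
  have hb := abs_logCyl_sub_le_pow hp (f k).valid hz (y := (f k).state.minEnd)
    ⟨by linarith, by linarith⟩
  have ht := abs_logCyl_sub_le_pow hp (f k).valid hz (y := (f k).state.topEnd (f k).level)
    ⟨by linarith, by linarith⟩
  rw [hlog] at hb ht
  have hxk : x k ∈ Set.uIcc ((f k).botVal p) ((f k).topVal p) := hx k
  rw [Set.mem_uIcc] at hxk
  rw [abs_le] at hb ht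
  change _ ≤ (f k).botVal p - _ ∧ (f k).botVal p - _ ≤ _ at hb
  change _ ≤ (f k).topVal p - _ ∧ (f k).topVal p - _ ≤ _ at ht
  rw [Real.dist_eq, abs_lt]
  rcases hxk with h | h <;> constructor <;> linarith [h.1, h.2, hb.1, hb.2, ht.1, ht.2]

/-- Points x and M - x in the linked intervals converge to the logarithms attached to the two
limiting tails, so these sum to M. -/
lemma exists_tails_of_linked {hp : 4 ≤ p} {hq : 4 ≤ q} {M : ℝ} {n m : CylNode}
    (h : GapTree.Linked (tree p hp) (tree q hq) M n m) :
    ∃ u v, AdmissibleTail u ∧ AdmissibleTail v ∧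
      Real.log (p + cfValue u) + Real.log (q + cfValue v) = M := by
  obtain ⟨f, g, hf, hg, hl⟩ := h.exists_seq
  obtain ⟨u, hu, hu'⟩ := exists_tail hf
  obtain ⟨v, hv, hv'⟩ := exists_tail hg
  choose x hx hy using fun k => (hl k).2.2
  refine ⟨u, v, hu, hv, ?_⟩
  have h1 := (hu' x hx).add (hv' (fun k => M - x k) hy)
  simp only [add_sub_cancel] at h1
  exact (tendsto_nhds_unique tendsto_const_nhds h1).symm

/-- The cylinder of all admissible tails. -/
def root : CylNode where
  word := []
  level := 0
  valid := trivial
  level_le := by simp [wordState, TailState.maxTerm]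

lemma log_le_log_of_mul_le {a b c d : ℝ} (ha : 0 < a) (hb : 0 < b) (hc : 0 < c) (hd : 0 < d)
    (h : a * d ≤ c * b) : Real.log a - Real.log b ≤ Real.log c - Real.log d := by
  rw [← Real.log_div ha.ne' hb.ne', ← Real.log_div hc.ne' hd.ne']
  exact Real.log_le_log (by positivity) ((div_le_div_iff₀ hb hd).2 h)

/-- The condition p ≤ q ≤ p + 1 keeps the two root intervals of comparable logarithmic size, so each
root gap fits into the other interval. -/
lemma linked_root (hp : 4 ≤ p) (hq : 4 ≤ q) (hpq : p ≤ q) (hqp : q ≤ p + 1) {T : ℝ}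
    (h1 : (p + 0.2613) * (q + 0.2613) ≤ T) (h2 : T ≤ (p + 0.8272) * (q + 0.8272)) :
    GapTree.Linked (tree p hp) (tree q hq) (Real.log T) root root := by
  have hp' : (4 : ℝ) ≤ p := by exact_mod_cast hp
  have hq' : (4 : ℝ) ≤ q := by exact_mod_cast hq
  have hpq' : (p : ℝ) ≤ q := by exact_mod_cast hpq
  have hqp' : (q : ℝ) ≤ p + 1 := by exact_mod_cast hqp
  have hbot : ∀ r : ℕ, root.botVal r = Real.log (r + 0.2613) := fun r => rfl
  have htop : ∀ r : ℕ, root.topVal r = Real.log (r + 0.8272) := fun r => by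
    simp [topVal, root, state, wordState, TailState.topEnd, logCyl, TailState.maxEnd]
  have hgb : ∀ r : ℕ, root.gapBotVal r = Real.log (r + 1 / 2.2073) := fun r => by
    simp only [gapBotVal, root, state, wordState, TailState.cylHigh, logCyl, TailState.next]
    norm_num [TailState.minEnd]
  have hgt : ∀ r : ℕ, root.gapTopVal r = Real.log (r + 1 / 1.8282) := fun r => by
    simp only [gapTopVal, root, state, wordState, TailState.cylLow, logCyl, TailState.next]
    norm_num [TailState.maxEnd]
  have hbt : ∀ r : ℕ, 4 ≤ r → root.botVal r ≤ root.topVal r := fun r hr => by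
    rw [hbot, htop]
    exact Real.log_le_log (by positivity) (by linarith)
  have hlo : ∀ (r : ℕ) (hr : 4 ≤ r), (tree r hr).lo root = Real.log (r + 0.2613) :=
    fun r hr => (min_eq_left (hbt r hr)).trans (hbot r)
  have hhi : ∀ (r : ℕ) (hr : 4 ≤ r), (tree r hr).hi root = Real.log (r + 0.8272) :=
    fun r hr => (max_eq_right (hbt r hr)).trans (htop r)
  have hgap : ∀ (r : ℕ) (hr : 4 ≤ r), (tree r hr).gap root =
      Real.log (r + 1 / 1.8282) - Real.log (r + 1 / 2.2073) := by
    intro r hr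
    change |root.gapTopVal r - root.gapBotVal r| = _
    rw [hgb, hgt, abs_of_nonneg]
    exact sub_nonneg.2 (Real.log_le_log (by positivity) (by norm_num))
  have hT : 0 < T := lt_of_lt_of_le (by positivity) h1
  have l1 := Real.log_le_log (by positivity) h1
  have l2 := Real.log_le_log hT h2
  rw [Real.log_mul (by positivity) (by positivity)] at l1 l2
  -- The least x in the first interval for which log T - x does not exceed the top of the second.
  refine ⟨?_, ?_, max (Real.log (p + 0.2613)) (Real.log T - Real.log (q + 0.8272)), ?_, ?_⟩
  · rw [hgap, hlo, hhi]
    exact log_le_log_of_mul_le (by positivity) (by positivity) (by positivity) (by positivity)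
      (by norm_num; nlinarith)
  · rw [hgap, hlo, hhi]
    exact log_le_log_of_mul_le (by positivity) (by positivity) (by positivity) (by positivity)
      (by norm_num; nlinarith)
  · rw [hlo, hhi]
    refine ⟨le_max_left _ _, max_le (Real.log_le_log (by positivity) (by linarith)) ?_⟩
    linarith
  · rw [hlo, hhi]
    have hb := Real.log_le_log (by positivity : 0 < (q : ℝ) + 0.2613)
      (by linarith : (q : ℝ) + 0.2613 ≤ q + 0.8272)
    rcases max_cases (Real.log (p + 0.2613)) (Real.log T - Real.log (q + 0.8272)) with
      ⟨h, h'⟩ | ⟨h, h'⟩ <;> rw [h] <;> constructor <;> linarith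

lemma exists_tails (hp : 4 ≤ p) (hq : 4 ≤ q) (hpq : p ≤ q) (hqp : q ≤ p + 1) {T : ℝ}
    (h1 : (p + 0.2613) * (q + 0.2613) ≤ T) (h2 : T ≤ (p + 0.8272) * (q + 0.8272)) :
    ∃ u v, AdmissibleTail u ∧ AdmissibleTail v ∧ (p + cfValue u) * (q + cfValue v) = T := by
  obtain ⟨u, v, hu, hv, h⟩ := exists_tails_of_linked (linked_root hp hq hpq hqp h1 h2)
  have hp' : (4 : ℝ) ≤ p := by exact_mod_cast hp
  have hq' : (4 : ℝ) ≤ q := by exact_mod_cast hq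
  have hu0 := cfValue_pos hu.terms.pos
  have hv0 := cfValue_pos hv.terms.pos
  have hT : 0 < T := lt_of_lt_of_le (by positivity) h1
  refine ⟨u, v, hu, hv, ?_⟩
  rw [← Real.log_mul (by positivity) (by positivity)] at h
  exact Real.log_injOn_pos (Set.mem_Ioi.2 (by positivity)) (Set.mem_Ioi.2 hT) h

end CylNode

/-! ### The ray in the Dirichlet spectrum -/

lemma AdmissibleTail.one_fourth_le {u : ℕ → ℕ} (hu : AdmissibleTail u) : 1 / 4 ≤ cfValue u := by
  have hz := cfValue_mem_Icc (dropTerms_pos hu.terms.pos 1)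
  have h3 : (u 0 : ℝ) ≤ 3 := by exact_mod_cast hu.head_le
  have h1 : (1 : ℝ) ≤ u 0 := by exact_mod_cast hu.terms.pos 0
  rw [cfValue_eq hu.terms.pos]
  exact one_div_le_one_div_of_le (by linarith [hz.1]) (by linarith [hz.2])

lemma extremal_product_gt : 18.4 < (3 + extremalTail) * extremalValue := by
  have := lt_extremalValue
  have := extremalTail_mem.1
  nlinarith

/-- The product ranges of the pairs (p, p) and (p, p + 1) overlap and cover every T from 4.2613² on.
The threshold T₀ is needed only when p = q = 4. -/
lemma div_add_one_mem_dirichletSpectrum {T : ℝ} (hT : (3 + extremalTail) * extremalValue ≤ T) :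
    T / (T + 1) ∈ dirichletSpectrum := by
  have hM := extremal_product_gt
  have hT0 : 0 ≤ T := by linarith
  have hsqrt : (4.2613 : ℝ) ≤ Real.sqrt T := Real.le_sqrt_of_sq_le (by norm_num; linarith)
  -- The largest p for which T is not below the range of the pair (p, p).
  set p := ⌊Real.sqrt T - 0.2613⌋₊ with hpdef
  have hp : 4 ≤ p := Nat.le_floor (by norm_num; linarith)
  have hp' : (4 : ℝ) ≤ p := by exact_mod_cast hp
  have hle : (p : ℝ) + 0.2613 ≤ Real.sqrt T := by
    have := Nat.floor_le (show (0 : ℝ) ≤ Real.sqrt T - 0.2613 by linarith)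
    rw [← hpdef] at this
    linarith
  have hlt : Real.sqrt T < p + 1 + 0.2613 := by
    have := Nat.lt_floor_add_one (Real.sqrt T - 0.2613)
    rw [← hpdef] at this
    linarith
  have hsq := Real.mul_self_sqrt hT0
  have h1 : ((p : ℝ) + 0.2613) * (p + 0.2613) ≤ T := by nlinarith
  have h2 : T < (p + 1 + 0.2613) * (p + 1 + 0.2613) := by nlinarith
  rcases le_or_gt T ((p + 0.8272) * (p + 0.8272)) with h | h
  · obtain ⟨u, v, hu, hv, hTe⟩ := CylNode.exists_tails hp hp le_rfl (by omega) h1 h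
    rcases Nat.eq_or_lt_of_le hp with h4 | h4
    · rw [← h4] at hTe
      push_cast at hTe
      rw [← hTe] at hT ⊢
      exact mem_dirichletSpectrum_of_extremal_le hu hv hT
    · have h5 : (5 : ℝ) ≤ p := by exact_mod_cast h4
      rw [← hTe]
      exact mem_dirichletSpectrum_of_large hp hp hu hv (by rw [hTe]; nlinarith) hu.one_fourth_le
        hv.one_fourth_le
  -- Here T lies between the ranges of (p, p) and (p + 1, p + 1); it exceeds 4.8272² > 20.
  · obtain ⟨u, v, hu, hv, hTe⟩ := CylNode.exists_tails (p := p) (q := p + 1) (T := T) hp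
      (by omega) (by omega) le_rfl (by push_cast; nlinarith) (by push_cast; nlinarith)
    rw [← hTe]
    exact mem_dirichletSpectrum_of_large hp (by omega) hu hv (by rw [hTe]; nlinarith)
      hu.one_fourth_le hv.one_fourth_le

lemma ray_start_mul : 111 * (397 + Real.sqrt 26565) / 65522 *
    ((3 + extremalTail) * extremalValue + 1) = (3 + extremalTail) * extremalValue := by
  have h1 := lt_extremalValue
  have h2 := extremalValue_sq
  have h3 : Real.sqrt 26565 = 58 * extremalValue - 117 := by
    unfold extremalValue
    ring
  rw [h3]
  unfold extremalTail
  generalize extremalValue = x at *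
  field_simp
  linear_combination (25752 * x / 29 - 280) * h2

theorem corollary1p4 :
    IsGLB dirichletRayPoints rayOriginConstant ∧
      rayOriginConstant ≤ 111 * (397 + Real.sqrt 26565) / 65522 ∧
      |111 * (397 + Real.sqrt 26565) / 65522 - 0.94866| < (1 : ℝ) / 10 ^ 5 := by
  have hmem : 111 * (397 + Real.sqrt 26565) / 65522 ∈ dirichletRayPoints := by
    rintro d ⟨hd, hd1⟩
    rcases eq_or_lt_of_le hd1 with rfl | hd1
    · exact one_mem_dirichletSpectrum
    have hM := extremal_product_gt
    have hstart := ray_start_mul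
    have hd2 : 0 < 1 - d := sub_pos.2 hd1
    -- The parameter T = d/(1 - d) inverts T/(T + 1) = d, and the claimed bound is T₀/(T₀ + 1).
    have hT : (3 + extremalTail) * extremalValue ≤ d / (1 - d) := by
      rw [le_div_iff₀ hd2]
      nlinarith
    have := div_add_one_mem_dirichletSpectrum hT
    have e : d / (1 - d) / (d / (1 - d) + 1) = d := by
      field_simp
      ring
    rwa [e] at this
  have hbdd : BddBelow dirichletRayPoints := by
    -- Any negative bound works: a ray starting below -1 would contain -1/2, but Dirichlet constants
    -- are nonnegative.
    refine ⟨-1, fun x hx => ?_⟩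
    by_contra hc
    push Not at hc
    obtain ⟨α, -, hα⟩ := hx (show (-1 / 2 : ℝ) ∈ Set.Ioc x 1 from ⟨by linarith, by norm_num⟩)
    linarith [dirichletConstant_nonneg α]
  refine ⟨isGLB_csInf ⟨_, hmem⟩ hbdd, csInf_le hbdd hmem, ?_⟩
  have h1 : (162.987 : ℝ) < Real.sqrt 26565 := Real.lt_sqrt_of_sq_lt (by norm_num)
  have h2 : Real.sqrt 26565 < (162.988 : ℝ) := (Real.sqrt_lt' (by norm_num)).2 (by norm_num)
  rw [abs_lt]
  constructor <;> norm_num <;> linarith
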